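/- Let $n\in\mathbb N$, $\alpha,\beta\in(0,1]$, $m>0$, $K_1,K_2>0$, $c_0>0$ and $N\ge 0$. There is a finite constant $A$, depending only on $n,\alpha,\beta,m,K_1,K_2,c_0,N$, with the following property. Let $E\subset\mathbb R^n$ be closed and let $S\colon(\mathbb R^n\setminus E)\times E\to\mathbb C$ be a kernel, Lebesgue measurable in its first variable, such that $$|S(x,y)|\le \frac{K_1}{|x-y|^{m+\alpha}}\qquad (x\in\mathbb R^n\setminus E,\ y\in E),$$ $$|S(x,y)-S(x,y')|\le K_2\frac{|y-y'|^{\beta}}{|x-y|^{m+\alpha+\beta}}\qquad \big(x\in\mathbb R^n\setminus E,\ y,y'\in E,\ |y-y'|\le \tfrac{|x-y|}{2}\big).$$ Let $d(x,E)$ be the distance from $x$ to $E$, let $d\sigma(x)=d(x,E)^{-n}\,dx$ on $\mathbb R^n\setminus E$, and for $y\in E$ let $\Gamma(y)=\{x\in\mathbb R^n\setminus E:|x-y|<2d(x,E)\}$. Let $\mathcal M(E)$ be the set of complex Borel measures on $\mathbb R^n$ with support in $E$, and $|\nu|$ the total variation of $\nu$. For a complex measure $\nu\in \mathcal M(E)$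 put $$T\nu(x)=\int_E S(x,z)\,d\nu(z),\qquad \mathcal C\nu(y)=\Big(\int_{\Gamma(y)}|T\nu(x)|^2d(x,E)^{2\alpha}\,d\sigma(x)\Big)^{1/2}\quad(y\in E),$$ and, for a non-negative Borel measure $\mu$ and $f\in L^2(\mu)$, $$T_\mu f(x)=\int_E S(x,z)f(z)\,d\mu(z),\qquad \mathcal C_\mu f(y)=\Big(\int_{\Gamma(y)}|T_\mu f(x)|^2d(x,E)^{2\alpha}\,d\sigma(x)\Big)^{1/2}\quad(y\in E).$$ Suppose that $\mu$ is a non-negative Borel measure of order $m$ in $E$ with constant $c_0$, that is, $\operatorname{supp}\mu\subset E$ and $\mu(B(y,r))\le c_0r^m$ for all $y\in E$ and $r>0$, and that $\mathcal C_\mu$ is bounded in $L^2(\mu)$ with norm at most $N$, that is, $\|\mathcal C_\mu f\|_{L^2(\mu)}\le N\|f\|_{L^2(\mu)}$ for all complex-valued $f\in L^2(\mu)$. Then $\mathcal C$ maps $\mathcal M(E)$ boundedly into $L^{1,\infty}(\mu)$ with constant $A$: for every $\nu\in\mathcal M(E)$ the function $\mathcal C\nu$ is $\mu$-measurable, and $$\mu\big(\{y\in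 E:\mathcal C\nu(y)>\lambda\}\big)\le\frac{A}{\lambda}\,|\nu|(E)\qquad\text{for all }\lambda>0.$$ -/

import Mathlib

open MeasureTheory Set
open scoped ENNReal NNReal

noncomputable section

namespace ConicalSq

/-- Square function kernels on `(ℝⁿ \ E) × E` with parameters `α, β, m, K₁, K₂`. The function `S` is
total, but only its values on `(ℝⁿ \ E) × E` matter. Continuity in the second variable is contained
in the Hölder estimate; in the first variable the kernel is Lebesgue measurable. -/
structure IsKernel {n : ℕ} (E : Set (EuclideanSpace ℝ (Fin n))) (α β m K₁ K₂ : ℝ)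
    (S : EuclideanSpace ℝ (Fin n) → EuclideanSpace ℝ (Fin n) → ℂ) : Prop where
  measurable : ∀ y ∈ E, AEStronglyMeasurable (fun x => S x y) (volume.restrict Eᶜ)
  size : ∀ x ∉ E, ∀ y ∈ E, ‖S x y‖ ≤ K₁ * (1 / dist x y ^ (m + α))
  holder : ∀ x ∉ E, ∀ y ∈ E, ∀ y' ∈ E, dist y y' ≤ dist x y / 2 →
    ‖S x y - S x y'‖ ≤ K₂ * (dist y y' ^ β / dist x y ^ (m + α + β))

/-- The Borel measure `μ` is of order `m` in `E`, with constant `c₀`. -/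
structure IsOfOrder {n : ℕ} (E : Set (EuclideanSpace ℝ (Fin n))) (m c₀ : ℝ)
    (μ : Measure (EuclideanSpace ℝ (Fin n))) : Prop where
  support_subset : μ.support ⊆ E
  ball_le : ∀ y ∈ E, ∀ r : ℝ, 0 < r → μ (Metric.ball y r) ≤ ENNReal.ofReal (c₀ * r ^ m)

/-- The set `M(E)` of complex Borel measures on `ℝⁿ` with support in `E`. -/
def complexMeasuresOn {n : ℕ} (E : Set (EuclideanSpace ℝ (Fin n))) :
    Set (ComplexMeasure (EuclideanSpace ℝ (Fin n))) :=
  {ν | ν.variation.support ⊆ E}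

/-- The measure `dσ(x) = d(x, E)⁻ⁿ dx` on `ℝⁿ \ E`. -/
def sigma {n : ℕ} (E : Set (EuclideanSpace ℝ (Fin n))) : Measure (EuclideanSpace ℝ (Fin n)) :=
  (volume.restrict Eᶜ).withDensity fun x => ENNReal.ofReal (1 / Metric.infDist x E ^ n)

/-- The cone `Γ(y) = {x ∈ ℝⁿ \ E : |x - y| < 2 d(x, E)}`. -/
def cone {n : ℕ} (E : Set (EuclideanSpace ℝ (Fin n))) (y : EuclideanSpace ℝ (Fin n)) :
    Set (EuclideanSpace ℝ (Fin n)) :=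
  {x | x ∉ E ∧ dist x y < 2 * Metric.infDist x E}

/-- The conical square integral `(∫_{Γ(y)} |g(x)|² d(x, E)^{2α} dσ(x))^{1/2}`, with values in
`[0, ∞]`. -/
def conicalIntegral {n : ℕ} (E : Set (EuclideanSpace ℝ (Fin n))) (α : ℝ)
    (g : EuclideanSpace ℝ (Fin n) → ℂ) (y : EuclideanSpace ℝ (Fin n)) : ℝ≥0∞ :=
  (∫⁻ x in cone E y, ‖g x‖ₑ ^ 2 * ENNReal.ofReal (Metric.infDist x E ^ (2 * α)) ∂(sigma E))
    ^ (1 / 2 : ℝ)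

/-- `T_μ f(x) = ∫_E S(x, z) f(z) dμ(z)`. -/
def opT {n : ℕ} (E : Set (EuclideanSpace ℝ (Fin n)))
    (S : EuclideanSpace ℝ (Fin n) → EuclideanSpace ℝ (Fin n) → ℂ)
    (μ : Measure (EuclideanSpace ℝ (Fin n))) (f : EuclideanSpace ℝ (Fin n) → ℂ)
    (x : EuclideanSpace ℝ (Fin n)) : ℂ :=
  ∫ z in E, S x z * f z ∂μ

/-- `T ν(x) = ∫_E S(x, z) dν(z)` for a complex measure `ν`. -/
def opTMeasure {n : ℕ} (E : Set (EuclideanSpace ℝ (Fin n)))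
    (S : EuclideanSpace ℝ (Fin n) → EuclideanSpace ℝ (Fin n) → ℂ)
    (ν : ComplexMeasure (EuclideanSpace ℝ (Fin n))) (x : EuclideanSpace ℝ (Fin n)) : ℂ :=
  VectorMeasure.integral (VectorMeasure.restrict ν E) (fun z => S x z)
    (ContinuousLinearMap.mul ℝ ℂ)

/-- The conical square function `C_μ f`. -/
def squareFun {n : ℕ} (E : Set (EuclideanSpace ℝ (Fin n))) (α : ℝ)
    (S : EuclideanSpace ℝ (Fin n) → EuclideanSpace ℝ (Fin n) → ℂ)
    (μ : Measure (EuclideanSpace ℝ (Fin n))) (f : EuclideanSpace ℝ (Fin n) → ℂ) :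
    EuclideanSpace ℝ (Fin n) → ℝ≥0∞ :=
  conicalIntegral E α (opT E S μ f)

/-- The conical square function `C ν` of a complex measure `ν`. -/
def squareFunMeasure {n : ℕ} (E : Set (EuclideanSpace ℝ (Fin n))) (α : ℝ)
    (S : EuclideanSpace ℝ (Fin n) → EuclideanSpace ℝ (Fin n) → ℂ)
    (ν : ComplexMeasure (EuclideanSpace ℝ (Fin n))) :
    EuclideanSpace ℝ (Fin n) → ℝ≥0∞ :=
  conicalIntegral E α (opTMeasure E S ν)

/-- `C_μ` is bounded in `L²(μ)` with norm at most `N`. -/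
def BoundedL2 {n : ℕ} (E : Set (EuclideanSpace ℝ (Fin n))) (α : ℝ)
    (S : EuclideanSpace ℝ (Fin n) → EuclideanSpace ℝ (Fin n) → ℂ)
    (μ : Measure (EuclideanSpace ℝ (Fin n))) (N : ℝ≥0) : Prop :=
  ∀ f : EuclideanSpace ℝ (Fin n) → ℂ, MemLp f 2 μ →
    eLpNorm (squareFun E α S μ f) 2 μ ≤ N * eLpNorm f 2 μ

end ConicalSq

end

namespace ConicalSq

/-! The argument is a Calderón–Zygmund decomposition of measures in the non-homogeneous style: `μ`
has growth of order `m` but need not be doubling.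

By approximation it suffices to treat finite sums `∑ a_y δ_y` of point masses in `E`, with a
constant independent of their number. Put `ω = ∑ |a_y| δ_y` and fix a level `t`. If `t μ(ℝⁿ)` is at
most the mass of `ω`, the estimate is trivial. Otherwise each atom has a last scale `r_y` in a
sequence of ratio 16 with `ω(B(y, 3r_y)) > t μ(B(y, 16r_y))` (`exists_stopping_scale`). Vitali's
lemma bounds the measure of the union of the balls `B(y, 3r_y)` by `ω(ℝⁿ)/t`, so this union may be
discarded (`measure_biUnion_ball_le`).

Growth of order `m` forces some later ball, of radius `R_y = 16^(l+1) r_y`, to be doubling; the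
first such scale is taken (`exists_doubling_scale`). The atom at `y` is compared with its mass
spread uniformly over a set `A_y ⊆ B(y, R_y)` having at least half the measure of the ball. The sets
are chosen by induction on the radius so that the sum of all spread masses has density at most a
constant times `t` (`exists_density_selection`). This sum is the good part: it is bounded by a
multiple of `t` and its `L¹` norm is at most the mass of `ω`, so the `L²` bound and Chebyshev's
inequality suffice (`mul_measure_squareFun_le`).

The bad part is a sum of differences between an atom and its spread version. Each has square
function integrable off `B(y, r_y)`, with integral at most a constant times `|a_y|`
(`IsKernel.setLIntegral_conicalIntegral_sub_le`). Between `r_y` and `16R_y` the atom contributes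
`dist^(-m)`; its integral does not diverge logarithmically, since no intermediate ball is doubling
and the last annuli dominate. The spread mass is handled there by `L²` boundedness and
Cauchy–Schwarz. Beyond `16R_y` the two have equal mass, and Hölder continuity of the kernel gives
the summable decay `R_y^β dist^(-m-β)`.

Kernel bounds pass to the square function because `d(x, E)` and `|x - y|` are comparable on `Γ(y)`,
which reduces matters to radial integrals (`lintegral_cone_rpow_le`). -/

lemma rpow_neg_le_of_le {a b p : ℝ} (ha : 0 < a) (hab : a ≤ b) (hp : 0 ≤ p) :
    b ^ (-p) ≤ a ^ (-p) :=
  Real.rpow_le_rpow_of_nonpos ha hab (by linarith)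

lemma exists_scale_of_one_le {s : ℝ} (hs : 1 ≤ s) :
    ∃ j : ℕ, (2 : ℝ) ^ j ≤ s ∧ s < 2 ^ (j + 1) :=
  exists_nat_pow_near hs (by norm_num)

lemma tsum_ofReal_geometric {q : ℝ} (h0 : 0 ≤ q) (h1 : q < 1) :
    ∑' j : ℕ, ENNReal.ofReal (q ^ j) = ENNReal.ofReal (1 - q)⁻¹ := by
  rw [← tsum_geometric_of_lt_one h0 h1,
    ENNReal.ofReal_tsum_of_nonneg (fun j => by positivity) (summable_geometric_of_lt_one h0 h1)]

/-- The constant in the estimates of integrals of powers of the distance. -/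
noncomputable def radialConst (a ε : ℝ) : ℝ := 2 ^ a * (1 - 2 ^ (-ε))⁻¹

lemma two_rpow_neg_lt_one {ε : ℝ} (hε : 0 < ε) : (2 : ℝ) ^ (-ε) < 1 :=
  Real.rpow_lt_one_of_one_lt_of_neg (by norm_num) (by linarith)

lemma radialConst_pos {a ε : ℝ} (hε : 0 < ε) : 0 < radialConst a ε := by
  have := two_rpow_neg_lt_one hε
  unfold radialConst
  have : 0 < 1 - (2 : ℝ) ^ (-ε) := by linarith
  positivity

lemma setLIntegral_le_of_le_on {X : Type*} [MeasurableSpace X] {μ : Measure X} {s t : Set X} {f : X → ℝ≥0∞} {c M : ℝ≥0∞}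
    (hst : s ⊆ t) (hs : MeasurableSet s) (hf : ∀ x ∈ s, f x ≤ c) (hM : μ t ≤ M) :
    ∫⁻ x in s, f x ∂μ ≤ c * M := by
  calc ∫⁻ x in s, f x ∂μ ≤ ∫⁻ _ in s, c ∂μ := setLIntegral_mono_ae' hs (.of_forall hf)
    _ = c * μ s := by simp
    _ ≤ c * M := by gcongr; exact (measure_mono hst).trans hM

lemma ofReal_mul_mul_ofReal_eq {A B P Q : ℝ} (C : ℝ≥0∞) (hA : 0 ≤ A) (hP : 0 ≤ P)
    (h : A * B = P * Q) :
    ENNReal.ofReal A * (C * ENNReal.ofReal B) = ENNReal.ofReal P * C * ENNReal.ofReal Q := by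
  rw [mul_left_comm, mul_right_comm, ← ENNReal.ofReal_mul hA, ← ENNReal.ofReal_mul hP, h, mul_comm]

/-! ### Integrals of powers of the distance under polynomial growth -/

section Metric

variable {X : Type*} [PseudoMetricSpace X] [MeasurableSpace X] [OpensMeasurableSpace X]

/-- On each dyadic annulus the growth of `μ` cancels the exponent `a` of the integrand up to the
factor `2 ^ a`; what remains is a geometric series of ratio `2 ^ (-ε)`. -/
lemma lintegral_dist_rpow_far_le {μ : Measure X} {y : X} {C : ℝ≥0∞} {a ε ρ : ℝ} (ha : 0 ≤ a)
    (hε : 0 < ε) (hρ : 0 < ρ)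
    (h : ∀ r : ℝ, 0 < r → μ (Metric.ball y r) ≤ C * ENNReal.ofReal (r ^ a)) :
    ∫⁻ x in {x | ρ ≤ dist x y}, ENNReal.ofReal (dist x y ^ (-(a + ε))) ∂μ ≤
      ENNReal.ofReal (radialConst a ε * ρ ^ (-ε)) * C := by
  set s : ℕ → Set X := fun j => {x | 2 ^ j * ρ ≤ dist x y ∧ dist x y < 2 ^ (j + 1) * ρ} with hs
  have hcont : Continuous fun x => dist x y := by fun_prop
  have hsm : ∀ j, MeasurableSet (s j) := fun j =>
    (measurableSet_le measurable_const hcont.measurable).inter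
      (measurableSet_lt hcont.measurable measurable_const)
  have hcov : {x | ρ ≤ dist x y} ⊆ ⋃ j, s j := by
    intro x hx
    obtain ⟨j, h1, h2⟩ := exists_scale_of_one_le ((one_le_div hρ).2 hx)
    rw [le_div_iff₀ hρ] at h1
    rw [div_lt_iff₀ hρ] at h2
    exact mem_iUnion.2 ⟨j, h1, h2⟩
  have hq := two_rpow_neg_lt_one hε
  have hj : ∀ j : ℕ, ∫⁻ x in s j, ENNReal.ofReal (dist x y ^ (-(a + ε))) ∂μ ≤
      ENNReal.ofReal (2 ^ a * ρ ^ (-ε)) * C * ENNReal.ofReal (((2 : ℝ) ^ (-ε)) ^ j) := by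
    intro j
    have hp : (0 : ℝ) < 2 ^ j * ρ := by positivity
    refine (setLIntegral_le_of_le_on (t := Metric.ball y (2 ^ (j + 1) * ρ)) (fun x hx => hx.2)
      (hsm j) (fun x hx => ENNReal.ofReal_le_ofReal
        (rpow_neg_le_of_le hp hx.1 (by linarith))) (h _ (by positivity))).trans ?_
    refine (ofReal_mul_mul_ofReal_eq C (by positivity) (by positivity) ?_).le
    have e1 : (2 : ℝ) ^ (j + 1) * ρ = 2 * (2 ^ j * ρ) := by ring
    rw [e1, Real.mul_rpow (by norm_num) hp.le, neg_add, Real.rpow_add hp]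
    have e2 : (2 ^ j * ρ) ^ (-a) * (2 ^ j * ρ) ^ a = 1 := by
      rw [← Real.rpow_add hp]; simp
    have e3 : (2 ^ j * ρ) ^ (-ε) = ((2 : ℝ) ^ (-ε)) ^ j * ρ ^ (-ε) := by
      rw [Real.mul_rpow (by positivity) hρ.le, ← Real.rpow_natCast, ← Real.rpow_natCast,
        ← Real.rpow_mul (by norm_num), ← Real.rpow_mul (by norm_num), mul_comm (j : ℝ)]
    linear_combination ((2 : ℝ) ^ a * (2 ^ j * ρ) ^ (-ε)) * e2 + 2 ^ a * e3
  calc _ ≤ ∫⁻ x in ⋃ j, s j, ENNReal.ofReal (dist x y ^ (-(a + ε))) ∂μ := lintegral_mono_set hcov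
    _ ≤ ∑' j, ∫⁻ x in s j, ENNReal.ofReal (dist x y ^ (-(a + ε))) ∂μ := lintegral_iUnion_le _ _
    _ ≤ ∑' j, ENNReal.ofReal (2 ^ a * ρ ^ (-ε)) * C * ENNReal.ofReal (((2 : ℝ) ^ (-ε)) ^ j) :=
      ENNReal.tsum_le_tsum hj
    _ = _ := by
      rw [ENNReal.tsum_mul_left, tsum_ofReal_geometric (by positivity) hq, mul_right_comm,
        ← ENNReal.ofReal_mul (by positivity), radialConst]
      congr 2; ring

/-- The same geometric series, with the annuli shrinking towards `y`. Points at distance zero lie in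
no annulus and have to be left out. -/
lemma lintegral_dist_rpow_near_le {μ : Measure X} {y : X} {C : ℝ≥0∞} {a ε ρ : ℝ} (ha : 0 ≤ a)
    (hε : 0 < ε) (hρ : 0 < ρ)
    (h : ∀ r : ℝ, 0 < r → μ (Metric.ball y r) ≤ C * ENNReal.ofReal (r ^ a)) :
    ∫⁻ x in {x | 0 < dist x y ∧ dist x y < ρ}, ENNReal.ofReal (dist x y ^ (ε - a)) ∂μ ≤
      ENNReal.ofReal (radialConst a ε * ρ ^ ε) * C := by
  set s : ℕ → Set X := fun j => {x | ρ / 2 ^ (j + 1) ≤ dist x y ∧ dist x y < ρ / 2 ^ j} with hs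
  have hcont : Continuous fun x => dist x y := by fun_prop
  have hsm : ∀ j, MeasurableSet (s j) := fun j =>
    (measurableSet_le measurable_const hcont.measurable).inter
      (measurableSet_lt hcont.measurable measurable_const)
  have hcov : {x | 0 < dist x y ∧ dist x y < ρ} ⊆ ⋃ j, s j := by
    rintro x ⟨h0, h1⟩
    have hlim : ∃ N : ℕ, ρ / 2 ^ (N + 1) ≤ dist x y := by
      obtain ⟨N, hN⟩ := pow_unbounded_of_one_lt (ρ / dist x y) (by norm_num : (1 : ℝ) < 2)
      refine ⟨N, ?_⟩
      rw [div_lt_iff₀ h0] at hN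
      rw [div_le_iff₀ (by positivity), pow_succ]
      nlinarith [mul_pos h0 (by positivity : (0 : ℝ) < 2 ^ N)]
    classical
    have hmin := fun k (hk : k < Nat.find hlim) => Nat.find_min hlim hk
    refine mem_iUnion.2 ⟨Nat.find hlim, Nat.find_spec hlim, ?_⟩
    rcases Nat.eq_zero_or_pos (Nat.find hlim) with h2 | h2
    · rw [h2]; simpa using h1
    · have := hmin (Nat.find hlim - 1) (by omega)
      rw [Nat.sub_add_cancel h2] at this
      exact not_le.1 this
  have hq := two_rpow_neg_lt_one hε
  have hj : ∀ j : ℕ, ∫⁻ x in s j, ENNReal.ofReal (dist x y ^ (ε - a)) ∂μ ≤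
      ENNReal.ofReal (2 ^ a * ρ ^ ε) * C * ENNReal.ofReal (((2 : ℝ) ^ (-ε)) ^ j) := by
    intro j
    have hp : (0 : ℝ) < ρ / 2 ^ j := by positivity
    have hp' : (0 : ℝ) < ρ / 2 ^ (j + 1) := by positivity
    refine (setLIntegral_le_of_le_on (t := Metric.ball y (ρ / 2 ^ j)) (fun x hx => hx.2)
      (c := ENNReal.ofReal ((ρ / 2 ^ j) ^ ε * (ρ / 2 ^ (j + 1)) ^ (-a)))
      (hsm j) (fun x hx => ENNReal.ofReal_le_ofReal ?_) (h _ (by positivity))).trans ?_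
    · have hd : 0 < dist x y := hp'.trans_le hx.1
      rw [sub_eq_add_neg, Real.rpow_add hd]
      exact mul_le_mul (Real.rpow_le_rpow hd.le hx.2.le hε.le) (rpow_neg_le_of_le hp' hx.1 ha)
        (by positivity) (by positivity)
    refine (ofReal_mul_mul_ofReal_eq C (by positivity) (by positivity) ?_).le
    have e1 : ρ / 2 ^ (j + 1) = 2⁻¹ * (ρ / 2 ^ j) := by rw [pow_succ]; field_simp
    have e2 : (ρ / 2 ^ j) ^ (-a) * (ρ / 2 ^ j) ^ a = 1 := by
      rw [← Real.rpow_add hp]; simp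
    have e4 : (2⁻¹ : ℝ) ^ (-a) = 2 ^ a := by
      rw [Real.inv_rpow (by norm_num), Real.rpow_neg (by norm_num), inv_inv]
    have e3 : (ρ / 2 ^ j) ^ ε = ((2 : ℝ) ^ (-ε)) ^ j * ρ ^ ε := by
      rw [Real.div_rpow hρ.le (by positivity), ← Real.rpow_natCast, ← Real.rpow_natCast,
        ← Real.rpow_mul (by norm_num), ← Real.rpow_mul (by norm_num), div_eq_mul_inv,
        ← Real.rpow_neg (by norm_num)]
      ring_nf
    rw [e1, Real.mul_rpow (by norm_num) hp.le, e4]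
    linear_combination ((2 : ℝ) ^ a * (ρ / 2 ^ j) ^ ε) * e2 + 2 ^ a * e3
  calc _ ≤ ∫⁻ x in ⋃ j, s j, ENNReal.ofReal (dist x y ^ (ε - a)) ∂μ := lintegral_mono_set hcov
    _ ≤ ∑' j, ∫⁻ x in s j, ENNReal.ofReal (dist x y ^ (ε - a)) ∂μ := lintegral_iUnion_le _ _
    _ ≤ ∑' j, ENNReal.ofReal (2 ^ a * ρ ^ ε) * C * ENNReal.ofReal (((2 : ℝ) ^ (-ε)) ^ j) :=
      ENNReal.tsum_le_tsum hj
    _ = _ := by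
      rw [ENNReal.tsum_mul_left, tsum_ofReal_geometric (by positivity) hq, mul_right_comm,
        ← ENNReal.ofReal_mul (by positivity), radialConst]
      congr 2; ring

/-- Between a ball and the first dilate of it that is doubling, the integral of the critical power
of the distance is bounded by the growth constant. -/
lemma lintegral_dist_rpow_annulus_le {μ : Measure X} {y : X} {m r : ℝ}
    (hm : 0 < m) (hr : 0 < r) (l : ℕ)
    (hnd : ∀ j, 1 ≤ j → j < l + 1 → ENNReal.ofReal (16 ^ (m + 1)) * μ (Metric.ball y (16 ^ j * r)) ≤
      μ (Metric.ball y (16 ^ (j + 1) * r))) :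
    ∫⁻ x in {x | r ≤ dist x y ∧ dist x y < 16 ^ (l + 1) * r},
        ENNReal.ofReal (dist x y ^ (-m)) ∂μ ≤
      ENNReal.ofReal (2 * 16 ^ m * (16 ^ (l + 1) * r) ^ (-m)) *
        μ (Metric.ball y (16 ^ (l + 1) * r)) := by
  have hcont : Continuous fun x => dist x y := by fun_prop
  have step : ∀ k : ℕ, ∫⁻ x in {x | 16 ^ k * r ≤ dist x y ∧ dist x y < 16 ^ (k + 1) * r},
      ENNReal.ofReal (dist x y ^ (-m)) ∂μ ≤
      ENNReal.ofReal (16 ^ m * (16 ^ (k + 1) * r) ^ (-m)) *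
        μ (Metric.ball y (16 ^ (k + 1) * r)) := by
    intro k
    have hp : (0 : ℝ) < 16 ^ k * r := by positivity
    refine setLIntegral_le_of_le_on (t := Metric.ball y (16 ^ (k + 1) * r)) (fun x hx => hx.2)
      ((measurableSet_le measurable_const hcont.measurable).inter
      (measurableSet_lt hcont.measurable measurable_const))
      (fun x hx => ENNReal.ofReal_le_ofReal ?_) le_rfl
    refine (rpow_neg_le_of_le hp hx.1 hm.le).trans_eq ?_
    have e1 : (16 : ℝ) ^ (k + 1) * r = 16 * (16 ^ k * r) := by ring
    rw [e1, Real.mul_rpow (by norm_num) hp.le, ← mul_assoc, ← Real.rpow_add (by norm_num)]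
    simp
  induction l with
  | zero =>
    have := step 0
    simp only [pow_zero, one_mul] at this
    refine this.trans ?_
    gcongr
    have : (0 : ℝ) < 16 ^ m := by positivity
    linarith
  | succ l ih =>
    have ih' := ih (fun j h1 h2 => hnd j h1 (by omega))
    have hsub : {x | r ≤ dist x y ∧ dist x y < 16 ^ (l + 1 + 1) * r} ⊆
        {x | r ≤ dist x y ∧ dist x y < 16 ^ (l + 1) * r} ∪
        {x | 16 ^ (l + 1) * r ≤ dist x y ∧ dist x y < 16 ^ (l + 1 + 1) * r} := by
      intro x hx
      rcases lt_or_ge (dist x y) (16 ^ (l + 1) * r) with h | h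
      · exact Or.inl ⟨hx.1, h⟩
      · exact Or.inr ⟨h, hx.2⟩
    refine (lintegral_mono_set hsub).trans ((lintegral_union_le _ _ _).trans ?_)
    have hp : (0 : ℝ) < 16 ^ (l + 1) * r := by positivity
    -- The ratio of measure to `radius ^ m` gains a factor of at least 16 at every non-doubling
    -- step. Hence twice the old term is at most one new term, and the factor 2 reproduces itself in
    -- the induction.
    have key : ENNReal.ofReal (2 * 16 ^ m * (16 ^ (l + 1) * r) ^ (-m)) *
        μ (Metric.ball y (16 ^ (l + 1) * r)) ≤
        ENNReal.ofReal (16 ^ m * (16 ^ (l + 1 + 1) * r) ^ (-m)) *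
          μ (Metric.ball y (16 ^ (l + 1 + 1) * r)) := by
      calc _ ≤ ENNReal.ofReal (16 ^ m * (16 ^ (l + 1 + 1) * r) ^ (-m)) *
          (ENNReal.ofReal (16 ^ (m + 1)) * μ (Metric.ball y (16 ^ (l + 1) * r))) := by
            rw [← mul_assoc, ← ENNReal.ofReal_mul (by positivity)]
            refine mul_le_mul_left (ENNReal.ofReal_le_ofReal ?_) _
            have e1 : (16 : ℝ) ^ (l + 1 + 1) * r = 16 * (16 ^ (l + 1) * r) := by ring
            have e2 : (16 : ℝ) ^ (-m) * 16 ^ (m + 1) = 16 := by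
              rw [← Real.rpow_add (by norm_num)]; simp
            rw [e1, Real.mul_rpow (x := 16) (by norm_num) hp.le]
            have : 0 < (16 : ℝ) ^ m * (16 ^ (l + 1) * r) ^ (-m) := by positivity
            have e3 : (16 : ℝ) ^ m * (16 ^ (-m) * (16 ^ (l + 1) * r) ^ (-m)) * 16 ^ (m + 1) =
              16 * (16 ^ m * (16 ^ (l + 1) * r) ^ (-m)) := by
              linear_combination (16 ^ m * (16 ^ (l + 1) * r) ^ (-m)) * e2
            rw [e3]
            nlinarith
        _ ≤ _ := by gcongr; exact hnd _ (by omega) (by omega)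
    refine (add_le_add (ih'.trans key) (step (l + 1))).trans_eq ?_
    rw [← add_mul, ← ENNReal.ofReal_add (by positivity) (by positivity)]
    congr 2; ring

end Metric

/-! ### Stopping scales, doubling scales, covering and spreading of mass -/

section Covering

variable {X : Type*} [PseudoMetricSpace X] [MeasurableSpace X]

lemma exists_mul_measure_ball_lt {μ : Measure X} {y : X} {C t w : ℝ≥0∞} {m : ℝ} (hm : 0 < m)
    (hC : C ≠ ∞) (ht : t ≠ ∞) (hw : 0 < w)
    (h : ∀ r : ℝ, 0 < r → μ (Metric.ball y r) ≤ C * ENNReal.ofReal (r ^ m)) :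
    ∃ r : ℝ, 0 < r ∧ t * μ (Metric.ball y (16 * r)) < w := by
  have hlim : Filter.Tendsto (fun r : ℝ => t * (C * ENNReal.ofReal ((16 * r) ^ m)))
      (nhdsWithin 0 (Ioi 0)) (nhds 0) := by
    have h1 : Filter.Tendsto (fun r : ℝ => (16 * r) ^ m) (nhdsWithin 0 (Ioi 0)) (nhds 0) := by
      have : Continuous fun r : ℝ => (16 * r) ^ m :=
        (continuous_const.mul continuous_id).rpow_const fun _ => Or.inr hm.le
      have h2 := (this.tendsto 0).mono_left (nhdsWithin_le_nhds (s := Ioi 0))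
      simpa [Real.zero_rpow hm.ne'] using h2
    have h2 := ENNReal.Tendsto.const_mul (ENNReal.Tendsto.const_mul (ENNReal.tendsto_ofReal h1)
      (Or.inr hC)) (Or.inr ht)
    simpa using h2
  obtain ⟨r, hr, hr0⟩ := ((hlim.eventually_lt_const hw).and self_mem_nhdsWithin).exists
  refine ⟨r, hr0, lt_of_le_of_lt ?_ hr⟩
  gcongr
  exact h _ (by have : (0 : ℝ) < r := hr0; positivity)

lemma exists_lt_mul_measure_ball {μ : Measure X} (y : X) {t V : ℝ≥0∞} {r : ℝ} (hr : 0 < r)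
    (h : V < t * μ univ) : ∃ j : ℕ, V < t * μ (Metric.ball y (16 ^ (j + 1) * r)) := by
  have hmono : Monotone fun j : ℕ => Metric.ball y (16 ^ (j + 1) * r) := fun i j hij =>
    Metric.ball_subset_ball (by gcongr; norm_num)
  have hU : ⋃ j : ℕ, Metric.ball y (16 ^ (j + 1) * r) = univ := by
    refine eq_univ_of_forall fun x => ?_
    obtain ⟨j, hj⟩ := pow_unbounded_of_one_lt (dist x y / r) (by norm_num : (1 : ℝ) < 16)
    rw [div_lt_iff₀ hr] at hj
    refine mem_iUnion.2 ⟨j, hj.trans_le ?_⟩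
    gcongr <;> norm_num
  rw [← hU, hmono.measure_iUnion, ENNReal.mul_iSup] at h
  exact lt_iSup_iff.1 h

/-- The stopping scale at `y`: the last scale at which the measure `ω` is large compared to `μ`. -/
lemma exists_stopping_scale {μ ω : Measure X} {y : X} {C t : ℝ≥0∞} {m : ℝ} (hm : 0 < m)
    (hC : C ≠ ∞) (ht : t ≠ ∞)
    (h : ∀ r : ℝ, 0 < r → μ (Metric.ball y r) ≤ C * ENNReal.ofReal (r ^ m))
    (hy : ∃ w > 0, ∀ r : ℝ, 0 < r → w ≤ ω (Metric.ball y r)) (hω : ω univ < t * μ univ) :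
    ∃ r : ℝ, 0 < r ∧ t * μ (Metric.ball y (16 * r)) < ω (Metric.ball y (3 * r)) ∧
      ∀ j : ℕ, 1 ≤ j →
        ω (Metric.ball y (3 * (16 ^ j * r))) ≤ t * μ (Metric.ball y (16 * (16 ^ j * r))) := by
  classical
  obtain ⟨w, hw, hy⟩ := hy
  obtain ⟨r, hr, hrw⟩ := exists_mul_measure_ball_lt hm hC ht hw h
  obtain ⟨J, hJ⟩ := exists_lt_mul_measure_ball y hr hω
  set P : ℕ → Prop := fun j =>
    ω (Metric.ball y (3 * (16 ^ j * r))) ≤ t * μ (Metric.ball y (16 * (16 ^ j * r))) with hP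
  -- At large scales the right side of `P` exceeds the whole mass of `ω`; at scale 0 the mass `w` at
  -- the centre makes `P` fail. The scale just before the first index from which `P` always holds is
  -- the required one.
  have hex : ∃ i, ∀ j ≥ i, P j := by
    refine ⟨J, fun j hj => (measure_mono (subset_univ _)).trans (hJ.le.trans ?_)⟩
    have : (16 : ℝ) ^ (J + 1) * r ≤ 16 * (16 ^ j * r) := by
      rw [pow_succ', mul_assoc]; gcongr; norm_num
    gcongr
  have hpos : Nat.find hex ≠ 0 := by
    intro h0
    have h1 := Nat.find_spec hex 0 (by omega)
    simp only [hP, pow_zero, one_mul] at h1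
    exact absurd (h1.trans_lt hrw) (not_lt.2 (hy _ (by positivity)))
  obtain ⟨i, hi⟩ := Nat.exists_eq_succ_of_ne_zero hpos
  have h1 : ¬ ∀ j ≥ i, P j := Nat.find_min hex (by omega)
  have h2 : ∀ j ≥ i + 1, P j := by have := Nat.find_spec hex; rwa [hi] at this
  have h3 : ¬ P i := fun h3 => h1 fun j hj => by
    rcases hj.lt_or_eq with h4 | h4
    · exact h2 j h4
    · exact h4 ▸ h3
  refine ⟨16 ^ i * r, by positivity, not_le.1 h3, fun j hj => ?_⟩
  have := h2 (i + j) (by omega)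
  rw [hP] at this
  simpa only [pow_add, mul_left_comm, mul_comm, mul_assoc] using this

/-- If no scale were doubling, the measure would grow by more than `16 ^ (m + 1)` at each step,
against the admissible `16 ^ m`. The search begins at `16 * r`, not `r`, so that the scale found
lies strictly beyond the stopping scale, where the reverse inequality between `ω` and `μ` is
available. -/
lemma exists_doubling_scale {μ : Measure X} {y : X} {C : ℝ≥0∞} {m r : ℝ}
    (hC : C ≠ ∞) (hr : 0 < r)
    (h : ∀ r : ℝ, 0 < r → μ (Metric.ball y r) ≤ C * ENNReal.ofReal (r ^ m))
    (hpos : 0 < μ (Metric.ball y (16 * (16 * r)))) :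
    ∃ l : ℕ,
      μ (Metric.ball y (16 * (16 ^ (l + 1) * r))) ≤
        ENNReal.ofReal (16 ^ (m + 1)) * μ (Metric.ball y (16 ^ (l + 1) * r)) ∧
      ∀ j, 1 ≤ j → j < l + 1 →
        ENNReal.ofReal (16 ^ (m + 1)) * μ (Metric.ball y (16 ^ j * r)) ≤
          μ (Metric.ball y (16 ^ (j + 1) * r)) := by
  classical
  have hex : ∃ l : ℕ, μ (Metric.ball y (16 * (16 ^ (l + 1) * r))) ≤
        ENNReal.ofReal (16 ^ (m + 1)) * μ (Metric.ball y (16 ^ (l + 1) * r)) := by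
    by_contra! hcon
    have hgrow : ∀ l : ℕ, ENNReal.ofReal ((16 ^ (m + 1)) ^ l) *
        μ (Metric.ball y (16 * (16 * r))) ≤ μ (Metric.ball y (16 * (16 ^ (l + 1) * r))) := by
      intro l
      induction l with
      | zero => simp
      | succ l ih =>
        have h1 := hcon (l + 1)
        rw [pow_succ' _ l, ENNReal.ofReal_mul (by positivity), mul_assoc]
        refine (mul_le_mul_right ih _).trans ((le_of_eq ?_).trans h1.le)
        rw [show (16 : ℝ) ^ (l + 1 + 1) * r = 16 * (16 ^ (l + 1) * r) by ring]
    have hbd : ∀ l : ℕ, ENNReal.ofReal (16 ^ l) * μ (Metric.ball y (16 * (16 * r))) ≤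
        C * ENNReal.ofReal ((256 * r) ^ m) := by
      intro l
      have h1 := (hgrow l).trans (h _ (by positivity))
      have e1 : ((16 : ℝ) ^ (m + 1)) ^ l = (16 ^ l) ^ m * 16 ^ l := by
        rw [Real.rpow_add (by norm_num), mul_pow, Real.rpow_one, ← Real.rpow_natCast,
          ← Real.rpow_natCast, ← Real.rpow_mul (by norm_num), ← Real.rpow_mul (by norm_num),
          mul_comm m]
      have e2 : ((16 : ℝ) * (16 ^ (l + 1) * r)) ^ m = (16 ^ l) ^ m * (256 * r) ^ m := by
        rw [← Real.mul_rpow (by positivity) (by positivity)]; congr 1; ring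
      rw [e1, e2, ENNReal.ofReal_mul (by positivity), ENNReal.ofReal_mul (by positivity),
        mul_assoc, mul_left_comm C] at h1
      exact (ENNReal.mul_le_mul_iff_right (by simp; positivity) ENNReal.ofReal_ne_top).1 h1
    have hfin : C * ENNReal.ofReal ((256 * r) ^ m) ≠ ∞ :=
      ENNReal.mul_ne_top hC ENNReal.ofReal_ne_top
    have hμ : μ (Metric.ball y (16 * (16 * r))) ≠ ∞ := ne_top_of_le_ne_top hfin (by
      simpa using hbd 0)
    obtain ⟨k, hk⟩ := ENNReal.exists_nat_mul_gt hpos.ne' hfin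
    refine absurd (hbd k) (not_le.2 (hk.trans_le ?_))
    gcongr
    rw [← ENNReal.ofReal_natCast]
    refine ENNReal.ofReal_le_ofReal ?_
    exact_mod_cast (Nat.lt_pow_self (by norm_num)).le
  refine ⟨Nat.find hex, Nat.find_spec hex, fun j h1 h2 => ?_⟩
  have := Nat.find_min hex (m := j - 1) (by omega)
  rw [not_le, Nat.sub_add_cancel h1] at this
  rw [pow_succ', mul_assoc]
  exact this.le

variable [OpensMeasurableSpace X]

/-- Vitali covering for the stopping balls. -/
lemma measure_biUnion_ball_le {μ ω : Measure X} (F : Finset X) (r : X → ℝ) {t : ℝ≥0∞}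
    (hr : ∀ y ∈ F, 0 < r y)
    (h : ∀ y ∈ F, t * μ (Metric.ball y (16 * r y)) ≤ ω (Metric.ball y (3 * r y))) :
    t * μ (⋃ y ∈ F, Metric.ball y (3 * r y)) ≤ ω univ := by
  classical
  obtain ⟨R, hR⟩ : ∃ R, ∀ y ∈ (F : Set X), 3 * r y ≤ R := by
    obtain ⟨R, hR⟩ := (F.image fun y => 3 * r y).exists_le
    exact ⟨R, fun y hy => hR _ (Finset.mem_image_of_mem _ hy)⟩
  -- The enlargement factor 5 turns radius `3 * r y` into `15 * r y`; the 16 in the stopping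
  -- condition leaves room for an open ball around it.
  obtain ⟨u, huF, hdisj, hcov⟩ := Vitali.exists_disjoint_subfamily_covering_enlargement_closedBall
    (F : Set X) id (fun y => 3 * r y) R hR 5 (by norm_num)
  have hufin : u.Finite := F.finite_toSet.subset huF
  lift u to Finset X using hufin
  have hsub : ⋃ y ∈ F, Metric.ball y (3 * r y) ⊆ ⋃ y ∈ u, Metric.ball y (16 * r y) := by
    refine iUnion₂_subset fun y hy => ?_
    obtain ⟨b, hb, hyb⟩ := hcov y hy
    have hrb := hr b (huF hb)
    refine Metric.ball_subset_closedBall.trans (hyb.trans ?_)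
    refine (Metric.closedBall_subset_ball (by change 5 * (3 * r b) < 16 * r b; linarith)).trans
      (subset_biUnion_of_mem (u := fun y => Metric.ball y (16 * r y)) hb)
  calc t * μ (⋃ y ∈ F, Metric.ball y (3 * r y))
      ≤ t * ∑ y ∈ u, μ (Metric.ball y (16 * r y)) := by
        gcongr
        exact (measure_mono hsub).trans (measure_biUnion_finset_le _ _)
    _ ≤ ∑ y ∈ u, ω (Metric.ball y (3 * r y)) := by
        rw [Finset.mul_sum]
        exact Finset.sum_le_sum fun y hy => h y (huF hy)
    _ = ω (⋃ y ∈ u, Metric.ball y (3 * r y)) := by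
        refine (measure_biUnion_finset (fun a ha b hb hab => ?_)
          fun _ _ => Metric.isOpen_ball.measurableSet).symm
        exact (hdisj ha hb hab).mono Metric.ball_subset_closedBall Metric.ball_subset_closedBall
    _ ≤ ω univ := measure_mono (subset_univ _)

/-- Sets of at least half the measure of the given balls, over which prescribed masses can be spread
with a bounded total density. -/
lemma exists_density_selection {μ : Measure X} (F : Finset X) (R : X → ℝ) (w : X → ℝ≥0∞)
    {M : ℝ≥0∞} (hM : M ≠ 0) (hM' : M ≠ ∞)
    (hμ0 : ∀ y ∈ F, μ (Metric.ball y (R y)) ≠ 0) (hμ : ∀ y ∈ F, μ (Metric.ball y (R y)) ≠ ∞)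
    (hw : ∀ y ∈ F, ∀ G ⊆ F, (∀ s ∈ G, s ∈ Metric.ball y (3 * R y)) →
      ∑ s ∈ G, w s ≤ M * μ (Metric.ball y (R y))) :
    ∃ A : X → Set X, (∀ y ∈ F, MeasurableSet (A y) ∧ A y ⊆ Metric.ball y (R y) ∧
      μ (Metric.ball y (R y)) ≤ 2 * μ (A y)) ∧
      ∀ z, ∑ y ∈ F, (A y).indicator (fun _ => w y / μ (A y)) z ≤ 4 * M := by
  classical
  -- The ball of largest radius is added last. Every earlier set that meets it then belongs to an
  -- atom within `3 * R a` of its centre, so the hypothesis on masses bounds the integral of the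
  -- earlier density `g` over this ball.
  induction F using Finset.induction_on_max_value R with
  | empty => exact ⟨fun _ => ∅, by simp, by simp⟩
  | insert a F ha hmax ih =>
    obtain ⟨A, hA, hsum⟩ := ih (fun y hy => hμ0 y (Finset.mem_insert_of_mem hy))
      (fun y hy => hμ y (Finset.mem_insert_of_mem hy))
      (fun y hy G hG => hw y (Finset.mem_insert_of_mem hy) G
        (hG.trans (Finset.subset_insert _ _)))
    set g : X → ℝ≥0∞ := fun z => ∑ y ∈ F, (A y).indicator (fun _ => w y / μ (A y)) z with hg
    have hgm : Measurable g := Finset.measurable_sum _ fun y hy =>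
      measurable_const.indicator (hA y hy).1
    set B := Metric.ball a (R a) with hB
    have hBm : MeasurableSet B := Metric.isOpen_ball.measurableSet
    have hint : ∫⁻ z in B, g z ∂μ ≤ M * μ B := by
      have h1 : ∫⁻ z in B, g z ∂μ = ∑ y ∈ F, w y / μ (A y) * μ (A y ∩ B) := by
        rw [hg, lintegral_finsetSum' _ fun y hy =>
          (measurable_const.indicator (hA y hy).1).aemeasurable]
        refine Finset.sum_congr rfl fun y hy => ?_
        rw [lintegral_indicator_const (hA y hy).1, Measure.restrict_apply (hA y hy).1]
      rw [h1, ← Finset.sum_filter_add_sum_filter_not F (fun y => (A y ∩ B).Nonempty)]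
      have h2 : ∑ y ∈ F with ¬ (A y ∩ B).Nonempty, w y / μ (A y) * μ (A y ∩ B) = 0 := by
        refine Finset.sum_eq_zero fun y hy => ?_
        rw [not_nonempty_iff_eq_empty.1 (Finset.mem_filter.1 hy).2]
        simp
      rw [h2, add_zero]
      refine le_trans (Finset.sum_le_sum (g := w) fun y hy => ?_)
        (hw a (Finset.mem_insert_self _ _) (F.filter fun y => (A y ∩ B).Nonempty)
          ((Finset.filter_subset _ _).trans (Finset.subset_insert _ _)) fun y hy => ?_)
      · calc w y / μ (A y) * μ (A y ∩ B) ≤ w y / μ (A y) * μ (A y) := by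
              gcongr; exact inter_subset_left
          _ ≤ w y := by rw [mul_comm]; exact ENNReal.mul_div_le
      · obtain ⟨hyF, z, hzA, hzB⟩ := Finset.mem_filter.1 hy
        have h3 : dist z y < R y := (hA y hyF).2.1 hzA
        have h4 : dist z a < R a := hzB
        have h5 := hmax y hyF
        have h6 := dist_triangle_left y a z
        rw [Metric.mem_ball]
        have := dist_nonneg (x := z) (y := a)
        linarith
    -- By Chebyshev, `g` reaches `2 * M` on at most half of `B`. On the remaining part the new
    -- density is also at most `2 * M`, which gives the total `4 * M`; outside it nothing changes.
    set A' := B ∩ {z | g z < 2 * M} with hA'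
    have hA'm : MeasurableSet A' := hBm.inter (measurableSet_lt hgm measurable_const)
    have hhalf : μ B ≤ 2 * μ A' := by
      have h2M : 2 * M ≠ 0 := by simp [hM]
      have h2M' : 2 * M ≠ ∞ := ENNReal.mul_ne_top (by simp) hM'
      have h1 := mul_meas_ge_le_lintegral (μ := μ.restrict B) hgm (2 * M)
      rw [Measure.restrict_apply (measurableSet_le measurable_const hgm)] at h1
      have h3 : 2 * M * μ ({z | 2 * M ≤ g z} ∩ B) ≤ M * μ B := h1.trans hint
      replace h3 : 2 * μ ({z | 2 * M ≤ g z} ∩ B) ≤ μ B := by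
        rwa [mul_right_comm, mul_comm, ENNReal.mul_le_mul_iff_right hM hM'] at h3
      have h4 : μ B ≤ μ A' + μ ({z | 2 * M ≤ g z} ∩ B) := by
        refine (measure_mono fun z hz => ?_).trans (measure_union_le _ _)
        rcases lt_or_ge (g z) (2 * M) with h | h
        · exact Or.inl ⟨hz, h⟩
        · exact Or.inr ⟨h, hz⟩
      have hfin := hμ a (Finset.mem_insert_self _ _)
      have h5 : 2 * μ B ≤ 2 * μ A' + μ B := by
        calc 2 * μ B ≤ 2 * (μ A' + μ ({z | 2 * M ≤ g z} ∩ B)) := by gcongr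
          _ = 2 * μ A' + 2 * μ ({z | 2 * M ≤ g z} ∩ B) := mul_add _ _ _
          _ ≤ _ := by gcongr
      rw [two_mul (μ B)] at h5
      exact (ENNReal.add_le_add_iff_right hfin).1 h5
    refine ⟨Function.update A a A', fun y hy => ?_, fun z => ?_⟩
    · rcases Finset.mem_insert.1 hy with rfl | hy
      · simp only [Function.update_self]
        exact ⟨hA'm, inter_subset_left, hhalf⟩
      · have : y ≠ a := fun h => ha (h ▸ hy)
        simpa only [Function.update_of_ne this] using hA y hy
    · rw [Finset.sum_insert ha]
      simp only [Function.update_self]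
      have h1 : ∑ y ∈ F, (Function.update A a A' y).indicator
          (fun _ => w y / μ (Function.update A a A' y)) z = g z := by
        refine Finset.sum_congr rfl fun y hy => ?_
        have : y ≠ a := fun h => ha (h ▸ hy)
        simp only [Function.update_of_ne this]
      rw [h1]
      by_cases hz : z ∈ A'
      · rw [indicator_of_mem hz]
        have hwa : w a ≤ M * μ B := by
          have hRa : 0 < R a := by
            by_contra hneg
            exact hμ0 a (Finset.mem_insert_self _ _) (by
              rw [Metric.ball_eq_empty.2 (not_lt.1 hneg)]; simp)
          have := hw a (Finset.mem_insert_self _ _) {a} (by simp) (by simpa using hRa)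
          simpa using this
        have h2 : w a / μ A' ≤ 2 * M := by
          refine ENNReal.div_le_of_le_mul (hwa.trans ?_)
          calc M * μ B ≤ M * (2 * μ A') := by gcongr
            _ = 2 * M * μ A' := by ring
        calc w a / μ A' + g z ≤ 2 * M + 2 * M := add_le_add h2 (le_of_lt hz.2)
          _ = 4 * M := by ring
      · rw [indicator_of_notMem hz, zero_add]
        exact hsum z

end Covering

/-! ### Conical square integrals -/

section Cone

variable {n : ℕ} {E : Set (EuclideanSpace ℝ (Fin n))}

lemma measurableSet_cone (hE : IsClosed E) (y : EuclideanSpace ℝ (Fin n)) :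
    MeasurableSet (cone E y) := by
  have h : IsOpen {x : EuclideanSpace ℝ (Fin n) | dist x y < 2 * Metric.infDist x E} :=
    isOpen_lt (by fun_prop) (by have := Metric.continuous_infDist_pt E; fun_prop)
  exact hE.isOpen_compl.measurableSet.inter h.measurableSet

/-- No measurability of `g` is needed: the integrand has a measurable minorant with the same
integral over every set, and Tonelli's theorem applies to that minorant on the open condition
defining the cones. -/
lemma measurable_conicalIntegral (hE : IsClosed E) (α : ℝ) (g : EuclideanSpace ℝ (Fin n) → ℂ) :
    Measurable (conicalIntegral E α g) := by
  unfold conicalIntegral sigma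
  obtain ⟨f, hf, -, hfg⟩ := exists_measurable_le_forall_setLIntegral_eq
    (μ := (volume.restrict Eᶜ).withDensity fun x : EuclideanSpace ℝ (Fin n) =>
      ENNReal.ofReal (1 / Metric.infDist x E ^ n))
    (fun x => ‖g x‖ₑ ^ 2 * ENNReal.ofReal (Metric.infDist x E ^ (2 * α)))
  simp_rw [hfg]
  refine Measurable.pow_const ?_ _
  have hs : MeasurableSet {p : EuclideanSpace ℝ (Fin n) × EuclideanSpace ℝ (Fin n) |
      p.2 ∈ cone E p.1} := by
    have h : IsOpen {p : EuclideanSpace ℝ (Fin n) × EuclideanSpace ℝ (Fin n) |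
        dist p.2 p.1 < 2 * Metric.infDist p.2 E} :=
      isOpen_lt (by fun_prop) (by have := Metric.continuous_infDist_pt E; fun_prop)
    exact (measurable_snd hE.isOpen_compl.measurableSet).inter h.measurableSet
  have h2 : (fun y => ∫⁻ x in cone E y, f x ∂(volume.restrict Eᶜ).withDensity fun x =>
      ENNReal.ofReal (1 / Metric.infDist x E ^ n)) = fun y =>
      ∫⁻ x, {p : EuclideanSpace ℝ (Fin n) × EuclideanSpace ℝ (Fin n) |
        p.2 ∈ cone E p.1}.indicator (fun p => f p.2) (y, x)
          ∂(volume.restrict Eᶜ).withDensity fun x =>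
      ENNReal.ofReal (1 / Metric.infDist x E ^ n) := by
    funext y
    rw [← lintegral_indicator (measurableSet_cone hE y)]
    rfl
  rw [h2]
  exact ((hf.comp measurable_snd).indicator hs).lintegral_prod_right'

/-- The measure with respect to which the conical square integral is an `L²` seminorm. -/
noncomputable def coneMeasure (E : Set (EuclideanSpace ℝ (Fin n))) (α : ℝ)
    (y : EuclideanSpace ℝ (Fin n)) : Measure (EuclideanSpace ℝ (Fin n)) :=
  ((sigma E).restrict (cone E y)).withDensity fun x =>
    ENNReal.ofReal (Metric.infDist x E ^ (2 * α))

lemma measurable_infDist_rpow (p : ℝ) :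
    Measurable fun x : EuclideanSpace ℝ (Fin n) =>
      ENNReal.ofReal (Metric.infDist x E ^ p) :=
  ((Metric.continuous_infDist_pt E).measurable.pow_const p).ennreal_ofReal

lemma coneMeasure_absolutelyContinuous (α : ℝ) (y : EuclideanSpace ℝ (Fin n)) :
    coneMeasure E α y ≪ volume.restrict Eᶜ :=
  (withDensity_absolutelyContinuous _ _).trans
    (Measure.absolutelyContinuous_of_le Measure.restrict_le_self |>.trans
      (withDensity_absolutelyContinuous _ _))

/-- This gives access to Minkowski's inequality and to Fatou's lemma for `L²` norms. -/
lemma conicalIntegral_eq_eLpNorm (α : ℝ) (g : EuclideanSpace ℝ (Fin n) → ℂ)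
    (y : EuclideanSpace ℝ (Fin n)) :
    conicalIntegral E α g y = eLpNorm g 2 (coneMeasure E α y) := by
  rw [eLpNorm_eq_lintegral_rpow_enorm_toReal (by simp) (by simp), coneMeasure,
    lintegral_withDensity_eq_lintegral_mul_non_measurable _ (measurable_infDist_rpow _)
      (.of_forall fun x => ENNReal.ofReal_lt_top), conicalIntegral]
  simp [mul_comm]

lemma conicalIntegral_add_le (α : ℝ) {g h : EuclideanSpace ℝ (Fin n) → ℂ}
    (hg : AEStronglyMeasurable g (volume.restrict Eᶜ))
    (hh : AEStronglyMeasurable h (volume.restrict Eᶜ)) (y : EuclideanSpace ℝ (Fin n)) :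
    conicalIntegral E α (g + h) y ≤ conicalIntegral E α g y + conicalIntegral E α h y := by
  simp_rw [conicalIntegral_eq_eLpNorm]
  exact eLpNorm_add_le (hg.mono_ac (coneMeasure_absolutelyContinuous α y))
    (hh.mono_ac (coneMeasure_absolutelyContinuous α y)) (by norm_num)

lemma conicalIntegral_sum_le (α : ℝ) {ι : Type*} (F : Finset ι)
    {g : ι → EuclideanSpace ℝ (Fin n) → ℂ}
    (hg : ∀ i ∈ F, AEStronglyMeasurable (g i) (volume.restrict Eᶜ))
    (y : EuclideanSpace ℝ (Fin n)) :
    conicalIntegral E α (∑ i ∈ F, g i) y ≤ ∑ i ∈ F, conicalIntegral E α (g i) y := by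
  simp_rw [conicalIntegral_eq_eLpNorm]
  exact eLpNorm_sum_le (fun i hi => (hg i hi).mono_ac (coneMeasure_absolutelyContinuous α y))
    (by norm_num)

lemma conicalIntegral_congr (hE : IsClosed E) (α : ℝ) {g h : EuclideanSpace ℝ (Fin n) → ℂ}
    (hgh : ∀ x ∉ E, g x = h x) (y : EuclideanSpace ℝ (Fin n)) :
    conicalIntegral E α g y = conicalIntegral E α h y := by
  unfold conicalIntegral
  congr 1
  refine setLIntegral_congr_fun (measurableSet_cone hE y) fun x hx => ?_
  simp only [hgh x hx.1]

/-- The constant in the estimate of the integral of a negative power over a cone. -/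
noncomputable def coneConst (n : ℕ) (s α : ℝ) : ℝ≥0∞ :=
  ENNReal.ofReal (2 ^ (n : ℝ) * 3 ^ (2 * (s + α)) * radialConst n (2 * α) +
    2 ^ (n + 2 * (s + α)) * radialConst n (2 * s)) *
    volume (Metric.ball (0 : EuclideanSpace ℝ (Fin n)) 1)

lemma coneConst_ne_top (n : ℕ) (s α : ℝ) : coneConst n s α ≠ ∞ :=
  ENNReal.mul_ne_top ENNReal.ofReal_ne_top measure_ball_lt_top.ne

lemma volume_ball_le (y : EuclideanSpace ℝ (Fin n)) (r : ℝ) (hr : 0 < r) :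
    volume (Metric.ball y r) ≤ volume (Metric.ball (0 : EuclideanSpace ℝ (Fin n)) 1) *
      ENNReal.ofReal (r ^ (n : ℝ)) := by
  rw [Measure.addHaar_ball_of_pos _ _ hr, mul_comm, Real.rpow_natCast]
  simp

/-- Here `d`, `r`, `δ`, `ρ` stand for `d(x, E)`, `|x - y|`, `|x - z|`, `|y - z|`. On the cone `d` is
comparable to `r`. Moreover `δ ≥ d > r / 2`, and `ρ ≤ r + δ < 2d + δ ≤ 3δ`, so `δ` is bounded below
by both `r / 2` and `ρ / 3`; the better bound is used in each range. -/
lemma rpow_bound_on_cone {d r δ ρ s α : ℝ} (hs : 0 < s) (hα : 0 < α)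
    (hd : 0 < d) (hdr : d ≤ r) (hr : r < 2 * d) (hdδ : d ≤ δ) (hρ : 0 < ρ) (hρδ : ρ ≤ r + δ) :
    1 / d ^ n * (δ ^ (-(2 * (s + α))) * d ^ (2 * α)) ≤
      if r < ρ then 2 ^ (n : ℝ) * 3 ^ (2 * (s + α)) * ρ ^ (-(2 * (s + α))) * r ^ (2 * α - n)
      else 2 ^ (n + 2 * (s + α)) * r ^ (-(n + 2 * s)) := by
  have hr0 : 0 < r := hd.trans_le hdr
  have hδ0 : 0 < δ := hd.trans_le hdδ
  have h1 : 1 / d ^ n ≤ 2 ^ (n : ℝ) * r ^ (-(n : ℝ)) := by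
    rw [Real.rpow_neg hr0.le, Real.rpow_natCast, Real.rpow_natCast, ← div_eq_mul_inv,
      div_le_div_iff₀ (by positivity) (by positivity), one_mul, ← mul_pow]
    gcongr
  have h2 : d ^ (2 * α) ≤ r ^ (2 * α) := by gcongr
  have h12 : 1 / d ^ n * d ^ (2 * α) ≤ 2 ^ (n : ℝ) * r ^ (2 * α - n) := by
    calc 1 / d ^ n * d ^ (2 * α) ≤ 2 ^ (n : ℝ) * r ^ (-(n : ℝ)) * r ^ (2 * α) := by gcongr
      _ = _ := by rw [mul_assoc, ← Real.rpow_add hr0]; ring_nf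
  have e1 : 1 / d ^ n * (δ ^ (-(2 * (s + α))) * d ^ (2 * α)) =
    1 / d ^ n * d ^ (2 * α) * δ ^ (-(2 * (s + α))) := by ring
  rw [e1]
  have hp : 0 ≤ 2 * (s + α) := by positivity
  split_ifs with h
  · have h3 : δ ^ (-(2 * (s + α))) ≤ 3 ^ (2 * (s + α)) * ρ ^ (-(2 * (s + α))) := by
      calc δ ^ (-(2 * (s + α))) ≤ (3⁻¹ * ρ) ^ (-(2 * (s + α))) :=
            rpow_neg_le_of_le (by positivity) (by linarith) hp
        _ = _ := by
          rw [Real.mul_rpow (by norm_num) hρ.le, Real.inv_rpow (by norm_num),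
            Real.rpow_neg (by norm_num), inv_inv]
    calc _ ≤ 2 ^ (n : ℝ) * r ^ (2 * α - n) * (3 ^ (2 * (s + α)) * ρ ^ (-(2 * (s + α)))) := by
          gcongr
      _ = _ := by ring
  · have h3 : δ ^ (-(2 * (s + α))) ≤ 2 ^ (2 * (s + α)) * r ^ (-(2 * (s + α))) := by
      calc δ ^ (-(2 * (s + α))) ≤ (2⁻¹ * r) ^ (-(2 * (s + α))) :=
            rpow_neg_le_of_le (by positivity) (by linarith) hp
        _ = _ := by
          rw [Real.mul_rpow (by norm_num) hr0.le, Real.inv_rpow (by norm_num),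
            Real.rpow_neg (by norm_num), inv_inv]
    calc _ ≤ 2 ^ (n : ℝ) * r ^ (2 * α - n) * (2 ^ (2 * (s + α)) * r ^ (-(2 * (s + α)))) := by
          gcongr
      _ = (2 ^ (n : ℝ) * 2 ^ (2 * (s + α))) * (r ^ (2 * α - n) * r ^ (-(2 * (s + α)))) := by ring
      _ = _ := by
        rw [← Real.rpow_add (by norm_num), ← Real.rpow_add hr0]; ring_nf

/-- Within distance `ρ = dist y z` of `y`, the power `2α - n` is integrable since `α > 0`; beyond
it, `-(n + 2s)` is integrable since `s > 0`. Both pieces scale as `ρ ^ (-2s)`. -/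
lemma lintegral_cone_rpow_le (hE : IsClosed E) {y z : EuclideanSpace ℝ (Fin n)} (hy : y ∈ E)
    (hz : z ∈ E) (hyz : 0 < dist y z) {s α : ℝ} (hs : 0 < s) (hα : 0 < α) :
    ∫⁻ x in cone E y, ENNReal.ofReal (dist x z ^ (-(2 * (s + α))) *
        Metric.infDist x E ^ (2 * α)) ∂(sigma E) ≤
      coneConst n s α * ENNReal.ofReal (dist y z ^ (-(2 * s))) := by
  set ρ := dist y z with hρ
  have hcm := measurableSet_cone hE y
  have hne : E.Nonempty := ⟨y, hy⟩
  have hm1 : Measurable fun x : EuclideanSpace ℝ (Fin n) =>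
      ENNReal.ofReal (1 / Metric.infDist x E ^ n) :=
    (((Metric.continuous_infDist_pt E).measurable.pow_const n).const_div 1).ennreal_ofReal
  set c1 : ℝ := 2 ^ (n : ℝ) * 3 ^ (2 * (s + α)) * ρ ^ (-(2 * (s + α))) with hc1
  set c2 : ℝ := 2 ^ (n + 2 * (s + α)) with hc2
  have hcont : Continuous fun x : EuclideanSpace ℝ (Fin n) => dist x y := by fun_prop
  set s1 : Set (EuclideanSpace ℝ (Fin n)) := {x | 0 < dist x y ∧ dist x y < ρ} with hs1
  set s2 : Set (EuclideanSpace ℝ (Fin n)) := {x | ρ ≤ dist x y} with hs2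
  have hs1m : MeasurableSet s1 := (measurableSet_lt measurable_const hcont.measurable).inter
    (measurableSet_lt hcont.measurable measurable_const)
  have hs2m : MeasurableSet s2 := measurableSet_le measurable_const hcont.measurable
  set V := volume (Metric.ball (0 : EuclideanSpace ℝ (Fin n)) 1) with hV
  calc _ ≤ ∫⁻ x in cone E y, ENNReal.ofReal (1 / Metric.infDist x E ^ n) *
        ENNReal.ofReal (dist x z ^ (-(2 * (s + α))) *
          Metric.infDist x E ^ (2 * α)) ∂(volume.restrict Eᶜ) := by
        rw [sigma, restrict_withDensity hcm]
        exact lintegral_withDensity_le_lintegral_mul _ hm1 _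
    _ ≤ ∫⁻ x in cone E y, ENNReal.ofReal (1 / Metric.infDist x E ^ n) *
        ENNReal.ofReal (dist x z ^ (-(2 * (s + α))) * Metric.infDist x E ^ (2 * α)) := by
        exact lintegral_mono' (Measure.restrict_mono_measure Measure.restrict_le_self _) le_rfl
    _ ≤ ∫⁻ x in cone E y,
        (s1.indicator (fun x => ENNReal.ofReal c1 * ENNReal.ofReal (dist x y ^ (2 * α - n))) x +
        s2.indicator (fun x => ENNReal.ofReal c2 *
          ENNReal.ofReal (dist x y ^ (-(n + 2 * s)))) x) := by
        refine setLIntegral_mono_ae' hcm (.of_forall fun x hx => ?_)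
        have hd : 0 < Metric.infDist x E := (hE.notMem_iff_infDist_pos hne).1 hx.1
        have hdr := Metric.infDist_le_dist_of_mem (x := x) hy
        have hb := rpow_bound_on_cone (n := n) hs hα hd hdr hx.2
          (Metric.infDist_le_dist_of_mem hz) hyz (dist_triangle_left y z x)
        rw [← ENNReal.ofReal_mul (by positivity)]
        refine (ENNReal.ofReal_le_ofReal hb).trans ?_
        split_ifs with h
        · have hx1 : x ∈ s1 := ⟨hd.trans_le hdr, h⟩
          rw [indicator_of_mem hx1, ← ENNReal.ofReal_mul (by positivity)]
          exact le_self_add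
        · have hx2 : x ∈ s2 := not_lt.1 h
          rw [indicator_of_mem hx2, ← ENNReal.ofReal_mul (by positivity)]
          exact le_add_self
    _ ≤ ∫⁻ x,
        (s1.indicator (fun x => ENNReal.ofReal c1 * ENNReal.ofReal (dist x y ^ (2 * α - n))) x +
        s2.indicator (fun x => ENNReal.ofReal c2 *
          ENNReal.ofReal (dist x y ^ (-(n + 2 * s)))) x) := setLIntegral_le_lintegral _ _
    _ = ENNReal.ofReal c1 * (∫⁻ x in s1, ENNReal.ofReal (dist x y ^ (2 * α - n))) +
        ENNReal.ofReal c2 * ∫⁻ x in s2, ENNReal.ofReal (dist x y ^ (-(n + 2 * s))) := by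
        rw [lintegral_add_left, lintegral_indicator hs1m, lintegral_indicator hs2m,
          lintegral_const_mul' _ _ ENNReal.ofReal_ne_top,
          lintegral_const_mul' _ _ ENNReal.ofReal_ne_top]
        refine Measurable.indicator ?_ hs1m
        exact ((hcont.measurable.pow_const _).ennreal_ofReal).const_mul _
    _ ≤ ENNReal.ofReal c1 * (ENNReal.ofReal (radialConst n (2 * α) * ρ ^ (2 * α)) * V) +
        ENNReal.ofReal c2 * (ENNReal.ofReal (radialConst n (2 * s) * ρ ^ (-(2 * s))) * V) := by
        gcongr
        · exact lintegral_dist_rpow_near_le (by positivity) (by positivity) hyz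
            fun r hr => volume_ball_le y r hr
        · exact lintegral_dist_rpow_far_le (by positivity) (by positivity) hyz
            fun r hr => volume_ball_le y r hr
    _ = _ := by
        have k1 : 0 < radialConst n (2 * α) := radialConst_pos (by positivity)
        have k2 : 0 < radialConst n (2 * s) := radialConst_pos (by positivity)
        rw [← mul_assoc, ← mul_assoc, ← add_mul, ← ENNReal.ofReal_mul (by positivity),
          ← ENNReal.ofReal_mul (by positivity), ← ENNReal.ofReal_add (by positivity)
          (by positivity), coneConst, mul_right_comm (ENNReal.ofReal _) (volume _), ← ENNReal.ofReal_mul (by positivity)]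
        congr 2
        have e : ρ ^ (-(2 * (s + α))) * ρ ^ (2 * α) = ρ ^ (-(2 * s)) := by
          rw [← Real.rpow_add hyz]; ring_nf
        rw [hc1, hc2, ← e]
        ring

/-- Pointwise kernel bounds give bounds of the conical square integral. -/
lemma conicalIntegral_le_of_norm_le (hE : IsClosed E) {y z : EuclideanSpace ℝ (Fin n)}
    (hy : y ∈ E) (hz : z ∈ E) (hyz : 0 < dist y z) {s α M : ℝ} (hs : 0 < s) (hα : 0 < α)
    (hM : 0 ≤ M) {g : EuclideanSpace ℝ (Fin n) → ℂ}
    (hg : ∀ x ∈ cone E y, ‖g x‖ ≤ M * dist x z ^ (-(s + α))) :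
    conicalIntegral E α g y ≤
      ENNReal.ofReal M * coneConst n s α ^ (1 / 2 : ℝ) * ENNReal.ofReal (dist y z ^ (-s)) := by
  have hbound : ∫⁻ x in cone E y, ‖g x‖ₑ ^ 2 * ENNReal.ofReal (Metric.infDist x E ^ (2 * α))
      ∂(sigma E) ≤ ENNReal.ofReal M ^ 2 *
        (coneConst n s α * ENNReal.ofReal (dist y z ^ (-(2 * s)))) := by
    calc _ ≤ ∫⁻ x in cone E y, ENNReal.ofReal M ^ 2 * ENNReal.ofReal
          (dist x z ^ (-(2 * (s + α))) * Metric.infDist x E ^ (2 * α)) ∂(sigma E) := by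
          refine setLIntegral_mono_ae' (measurableSet_cone hE y) (.of_forall fun x hx => ?_)
          have hd : 0 < Metric.infDist x E :=
            (hE.notMem_iff_infDist_pos ⟨y, hy⟩).1 hx.1
          have hxz : 0 < dist x z := hd.trans_le (Metric.infDist_le_dist_of_mem hz)
          have h1 : ‖g x‖ₑ ≤ ENNReal.ofReal (M * dist x z ^ (-(s + α))) := by
            rw [← ofReal_norm]; exact ENNReal.ofReal_le_ofReal (hg x hx)
          rw [ENNReal.ofReal_mul (p := dist x z ^ _) (by positivity), ← mul_assoc]
          gcongr
          calc ‖g x‖ₑ ^ 2 ≤ ENNReal.ofReal (M * dist x z ^ (-(s + α))) ^ 2 := by gcongr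
            _ = _ := by
              rw [ENNReal.ofReal_mul hM, mul_pow, ← ENNReal.ofReal_pow (p := _ ^ _) (by positivity),
                ← Real.rpow_natCast (_ ^ _), ← Real.rpow_mul hxz.le]
              congr 3; push_cast; ring
      _ = ENNReal.ofReal M ^ 2 * ∫⁻ x in cone E y, ENNReal.ofReal
          (dist x z ^ (-(2 * (s + α))) * Metric.infDist x E ^ (2 * α)) ∂(sigma E) :=
          lintegral_const_mul' _ _ (by finiteness)
      _ ≤ _ := by gcongr; exact lintegral_cone_rpow_le hE hy hz hyz hs hα
  have e : ENNReal.ofReal M ^ 2 * (coneConst n s α * ENNReal.ofReal (dist y z ^ (-(2 * s)))) =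
      (ENNReal.ofReal M * coneConst n s α ^ (1 / 2 : ℝ) * ENNReal.ofReal (dist y z ^ (-s))) ^ 2 := by
    rw [mul_pow, mul_pow, ← ENNReal.ofReal_pow (p := _ ^ _) (by positivity),
      ← Real.rpow_natCast (_ ^ _), ← Real.rpow_mul hyz.le, ← ENNReal.rpow_natCast (_ ^ _),
      ← ENNReal.rpow_mul, mul_assoc]
    norm_num
    ring_nf
  rw [e] at hbound
  unfold conicalIntegral
  refine (ENNReal.rpow_le_rpow hbound (by norm_num)).trans_eq ?_
  rw [← ENNReal.rpow_natCast, ← ENNReal.rpow_mul]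
  norm_num

end Cone

lemma simpleFunc_comp_eq_sum_indicator {X Y Z : Type*} [MeasurableSpace X] [AddCommMonoid Z]
    (p : SimpleFunc X Y) (h : Y → Z) (x : X) :
    h (p x) = ∑ y ∈ p.range, (p ⁻¹' {y}).indicator (fun _ => h y) x := by
  classical
  rw [Finset.sum_eq_single (p x)]
  · simp
  · intro b _ hb
    exact indicator_of_notMem (fun h => hb h.symm) _
  · intro hx
    exact absurd (p.mem_range_self x) hx

/-! ### Regularity of the kernel and cancellation -/

section Kernel

variable {n : ℕ} {E : Set (EuclideanSpace ℝ (Fin n))} {α β m K₁ K₂ : ℝ}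
  {S : EuclideanSpace ℝ (Fin n) → EuclideanSpace ℝ (Fin n) → ℂ}

lemma IsKernel.continuousOn (hS : IsKernel E α β m K₁ K₂ S) (hβ : 0 < β)
    {x : EuclideanSpace ℝ (Fin n)} (hx : x ∉ E) : ContinuousOn (S x) E := by
  intro y hy
  have hxy : 0 < dist x y := dist_pos.2 fun h => hx (h ▸ hy)
  rw [ContinuousWithinAt, tendsto_iff_norm_sub_tendsto_zero]
  have hlim : Filter.Tendsto (fun z => K₂ * (dist y z ^ β / dist x y ^ (m + α + β)))
      (nhdsWithin y E) (nhds 0) := by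
    have h1 : Continuous fun z => K₂ * (dist y z ^ β / dist x y ^ (m + α + β)) := by
      have : Continuous fun z => dist y z ^ β :=
        Continuous.rpow_const (by fun_prop) fun _ => Or.inr hβ.le
      fun_prop
    have h2 := (h1.tendsto y).mono_left (nhdsWithin_le_nhds (s := E))
    simpa [Real.zero_rpow hβ.ne'] using h2
  refine squeeze_zero' (.of_forall fun _ => norm_nonneg _) ?_ hlim
  have hball : Metric.ball y (dist x y / 2) ∈ nhdsWithin y E :=
    mem_nhdsWithin_of_mem_nhds (Metric.ball_mem_nhds y (by positivity))
  filter_upwards [hball, self_mem_nhdsWithin] with z hz hzE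
  rw [norm_sub_rev]
  exact hS.holder x hx y hy z hzE (by rw [dist_comm]; exact (Metric.mem_ball.1 hz).le)

lemma IsKernel.norm_le (hE : IsClosed E) (hS : IsKernel E α β m K₁ K₂ S) (hK₁ : 0 < K₁)
    (hmα : 0 ≤ m + α)
    {x y : EuclideanSpace ℝ (Fin n)} (hx : x ∉ E) (hy : y ∈ E) :
    ‖S x y‖ ≤ K₁ * Metric.infDist x E ^ (-(m + α)) := by
  have hd : 0 < Metric.infDist x E := (hE.notMem_iff_infDist_pos ⟨y, hy⟩).1 hx
  have hle := Metric.infDist_le_dist_of_mem (x := x) hy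
  refine (hS.size x hx y hy).trans ?_
  rw [one_div, ← Real.rpow_neg dist_nonneg]
  gcongr 1
  exact rpow_neg_le_of_le hd hle hmα

lemma IsKernel.integrable (hE : IsClosed E) (hS : IsKernel E α β m K₁ K₂ S) (hK₁ : 0 < K₁)
    (hmα : 0 ≤ m + α) (hβ : 0 < β) {κ : Measure (EuclideanSpace ℝ (Fin n))} [IsFiniteMeasure κ]
    (hκ : ∀ᵐ z ∂κ, z ∈ E) {x : EuclideanSpace ℝ (Fin n)} (hx : x ∉ E) :
    Integrable (S x) κ := by
  have hrest : κ.restrict E = κ := Measure.restrict_eq_self_of_ae_mem hκ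
  have hmeas : AEStronglyMeasurable (S x) κ := by
    rw [← hrest]
    exact (hS.continuousOn hβ hx).aestronglyMeasurable hE.measurableSet
  refine ⟨hmeas, HasFiniteIntegral.of_bounded (C := K₁ * Metric.infDist x E ^ (-(m + α))) ?_⟩
  filter_upwards [hκ] with z hz using hS.norm_le hE hK₁ hmα hx hz

lemma tendsto_approxOn_id {y₀ : EuclideanSpace ℝ (Fin n)} (h₀ : y₀ ∈ E)
    {z : EuclideanSpace ℝ (Fin n)} (hz : z ∈ E) :
    Filter.Tendsto (fun k => SimpleFunc.approxOn id measurable_id E y₀ h₀ k z) Filter.atTop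
      (nhdsWithin z E) :=
  tendsto_nhdsWithin_iff.2 ⟨SimpleFunc.tendsto_approxOn measurable_id h₀ (subset_closure hz),
    .of_forall fun _ => SimpleFunc.approxOn_mem _ _ _ _⟩

/-- Joint measurability of `S` is not assumed. Continuity in the second variable allows `z` to be
replaced by simple functions with values in `E`; the integral becomes a limit of finite combinations
of the measurable functions `S · y`. -/
lemma IsKernel.aestronglyMeasurable_integral (hE : IsClosed E) (hS : IsKernel E α β m K₁ K₂ S)
    (hK₁ : 0 < K₁) (hmα : 0 ≤ m + α) (hβ : 0 < β)
    {κ : Measure (EuclideanSpace ℝ (Fin n))} [IsFiniteMeasure κ] (hκ : ∀ᵐ z ∂κ, z ∈ E) :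
    AEStronglyMeasurable (fun x => ∫ z, S x z ∂κ) (volume.restrict Eᶜ) := by
  rcases E.eq_empty_or_nonempty with h0 | ⟨y₀, h₀⟩
  · have : κ = 0 := by
      rw [← ae_eq_bot, ← Filter.eventually_false_iff_eq_bot]
      simpa [h0] using hκ
    simpa [this] using aestronglyMeasurable_const
  set p := SimpleFunc.approxOn id measurable_id E y₀ h₀ with hp
  have hmem : ∀ k z, p k z ∈ E := fun k z => SimpleFunc.approxOn_mem _ _ _ _
  have hlim : ∀ x ∉ E, Filter.Tendsto (fun k => ∫ z, S x (p k z) ∂κ) Filter.atTop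
      (nhds (∫ z, S x z ∂κ)) := by
    intro x hx
    refine tendsto_integral_of_dominated_convergence
      (fun _ => K₁ * Metric.infDist x E ^ (-(m + α))) (fun k => ?_) (integrable_const _)
      (fun k => .of_forall fun z => hS.norm_le hE hK₁ hmα hx (hmem k z)) ?_
    · exact ((p k).map (S x)).aestronglyMeasurable
    · filter_upwards [hκ] with z hz
      exact (hS.continuousOn hβ hx z hz).tendsto.comp (tendsto_approxOn_id h₀ hz)
  refine aestronglyMeasurable_of_tendsto_ae Filter.atTop
    (f := fun k x => ∫ z, S x (p k z) ∂κ) (fun k => ?_) ?_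
  · have heq : (fun x => ∫ z, S x (p k z) ∂κ) =
        fun x => ∑ y ∈ (p k).range, κ.real ((p k) ⁻¹' {y}) • S x y := by
      funext x
      simp_rw [simpleFunc_comp_eq_sum_indicator (p k) (S x)]
      rw [integral_finsetSum _ fun y _ => (integrable_const _).indicator
        ((p k).measurableSet_fiber y)]
      simp_rw [integral_indicator_const _ ((p k).measurableSet_fiber _)]
    rw [heq]
    refine Finset.aestronglyMeasurable_fun_sum _ fun y hy => ?_
    obtain ⟨z, rfl⟩ := SimpleFunc.mem_range.1 hy
    exact (hS.measurable _ (hmem k z)).const_smul (κ.real ((p k) ⁻¹' {p k z}))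
  · filter_upwards [ae_restrict_mem hE.measurableSet.compl] with x hx using hlim x hx

/-- `∫_{A ∩ E} S(x, z) dμ(z)`. -/
noncomputable def kernelMean (E : Set (EuclideanSpace ℝ (Fin n)))
    (S : EuclideanSpace ℝ (Fin n) → EuclideanSpace ℝ (Fin n) → ℂ)
    (μ : Measure (EuclideanSpace ℝ (Fin n))) (A : Set (EuclideanSpace ℝ (Fin n)))
    (x : EuclideanSpace ℝ (Fin n)) : ℂ :=
  ∫ z in A ∩ E, S x z ∂μ

variable {μ : Measure (EuclideanSpace ℝ (Fin n))} {A : Set (EuclideanSpace ℝ (Fin n))}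

lemma isFiniteMeasure_restrict_inter (hA : μ A ≠ ∞) : IsFiniteMeasure (μ.restrict (A ∩ E)) :=
  ⟨by
    rw [Measure.restrict_apply_univ]
    exact (measure_mono inter_subset_left).trans_lt hA.lt_top⟩

lemma ae_mem_restrict_inter (hE : IsClosed E) (hA : MeasurableSet A) :
    ∀ᵐ z ∂μ.restrict (A ∩ E), z ∈ A ∩ E := ae_restrict_mem (hA.inter hE.measurableSet)

lemma IsKernel.integrableOn (hE : IsClosed E) (hS : IsKernel E α β m K₁ K₂ S) (hK₁ : 0 < K₁)
    (hmα : 0 ≤ m + α) (hβ : 0 < β) (hA : MeasurableSet A) (hμA : μ A ≠ ∞)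
    {x : EuclideanSpace ℝ (Fin n)} (hx : x ∉ E) : IntegrableOn (S x) (A ∩ E) μ := by
  have := isFiniteMeasure_restrict_inter (E := E) hμA
  exact hS.integrable hE hK₁ hmα hβ ((ae_mem_restrict_inter hE hA).mono fun _ h => h.2) hx

lemma IsKernel.aestronglyMeasurable_kernelMean (hE : IsClosed E) (hS : IsKernel E α β m K₁ K₂ S)
    (hK₁ : 0 < K₁) (hmα : 0 ≤ m + α) (hβ : 0 < β) (hA : MeasurableSet A) (hμA : μ A ≠ ∞) :
    AEStronglyMeasurable (kernelMean E S μ A) (volume.restrict Eᶜ) := by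
  have := isFiniteMeasure_restrict_inter (E := E) hμA
  exact hS.aestronglyMeasurable_integral hE hK₁ hmα hβ
    ((ae_mem_restrict_inter hE hA).mono fun _ h => h.2)

lemma IsKernel.opT_sum_indicator (hE : IsClosed E) (hS : IsKernel E α β m K₁ K₂ S)
    (hK₁ : 0 < K₁) (hmα : 0 ≤ m + α) (hβ : 0 < β) {ι : Type*} (F : Finset ι)
    {B : ι → Set (EuclideanSpace ℝ (Fin n))} (c : ι → ℂ)
    (hB : ∀ i ∈ F, MeasurableSet (B i)) (hμB : ∀ i ∈ F, μ (B i) ≠ ∞)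
    {x : EuclideanSpace ℝ (Fin n)} (hx : x ∉ E) :
    opT E S μ (fun z => ∑ i ∈ F, (B i).indicator (fun _ => c i) z) x =
      ∑ i ∈ F, c i * kernelMean E S μ (B i) x := by
  have h1 : ∀ i z, S x z * (B i).indicator (fun _ => c i) z =
      (B i).indicator (fun z => c i * S x z) z := fun i z => by
    by_cases h : z ∈ B i <;> simp [h, mul_comm]
  unfold opT
  simp_rw [Finset.mul_sum, h1]
  rw [integral_finsetSum]
  · refine Finset.sum_congr rfl fun i hi => ?_
    rw [integral_indicator (hB i hi), Measure.restrict_restrict (hB i hi), kernelMean,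
      integral_const_mul]
  · intro i hi
    rw [integrable_indicator_iff (hB i hi), IntegrableOn, Measure.restrict_restrict (hB i hi)]
    exact (hS.integrableOn hE hK₁ hmα hβ (hB i hi) (hμB i hi) hx).const_mul _

lemma IsKernel.opT_indicator (hE : IsClosed E) (hS : IsKernel E α β m K₁ K₂ S)
    (hK₁ : 0 < K₁) (hmα : 0 ≤ m + α) (hβ : 0 < β) (c : ℂ) (hA : MeasurableSet A) (hμA : μ A ≠ ∞)
    {x : EuclideanSpace ℝ (Fin n)} (hx : x ∉ E) :
    opT E S μ (A.indicator fun _ => c) x = c * kernelMean E S μ A x := by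
  have := hS.opT_sum_indicator hE hK₁ hmα hβ (μ := μ) (Finset.univ : Finset Unit) (B := fun _ => A)
    (fun _ => c) (fun _ _ => hA) (fun _ _ => hμA) hx
  simpa using this

lemma IsKernel.conicalIntegral_le (hE : IsClosed E) (hS : IsKernel E α β m K₁ K₂ S)
    (hK₁ : 0 < K₁) (hm : 0 < m) (hα : 0 < α) (a : ℂ) {y y₀ : EuclideanSpace ℝ (Fin n)}
    (hy : y ∈ E) (hy₀ : y₀ ∈ E) (hyy : 0 < dist y y₀) :
    conicalIntegral E α (fun x => a * S x y₀) y ≤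
      ‖a‖ₑ * ENNReal.ofReal K₁ * coneConst n m α ^ (1 / 2 : ℝ) *
        ENNReal.ofReal (dist y y₀ ^ (-m)) := by
  rw [← ofReal_norm, ← ENNReal.ofReal_mul (norm_nonneg a)]
  refine conicalIntegral_le_of_norm_le hE hy hy₀ hyy hm hα (by positivity) fun x hx => ?_
  rw [norm_mul, mul_assoc]
  gcongr
  rw [Real.rpow_neg dist_nonneg, ← one_div]
  exact hS.size x hx.1 y₀ hy₀

/-- Off a dilate of a ball around `y₀`, the Hölder regularity of the kernel yields extra decay for
a point mass minus its average over a subset of the ball. -/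
lemma IsKernel.conicalIntegral_sub_le (hE : IsClosed E) (hS : IsKernel E α β m K₁ K₂ S)
    (hK₁ : 0 < K₁) (hK₂ : 0 < K₂) (hm : 0 < m) (hα : 0 < α) (hβ : 0 < β)
    (hμE : ∀ᵐ z ∂μ, z ∈ E)
    {a c : ℂ} {y y₀ : EuclideanSpace ℝ (Fin n)} {R : ℝ} (hR : 0 < R)
    (hA : MeasurableSet A) (hμA : μ A ≠ ∞) (hAR : A ⊆ Metric.ball y₀ R) (hac : a = c * μ.real A)
    (hy : y ∈ E) (hy₀ : y₀ ∈ E) (hyy : 6 * R ≤ dist y y₀) :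
    conicalIntegral E α (fun x => a * S x y₀ - c * kernelMean E S μ A x) y ≤
      ‖a‖ₑ * ENNReal.ofReal (K₂ * R ^ β) * coneConst n (m + β) α ^ (1 / 2 : ℝ) *
        ENNReal.ofReal (dist y y₀ ^ (-(m + β))) := by
  rw [← ofReal_norm, ← ENNReal.ofReal_mul (norm_nonneg a)]
  refine conicalIntegral_le_of_norm_le hE hy hy₀ (by linarith) (by positivity) hα
    (by positivity) fun x hx => ?_
  have hx0 := hx.2
  have h1 : Metric.infDist x E ≤ dist x y₀ := Metric.infDist_le_dist_of_mem hy₀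
  have h2 := dist_triangle_left y y₀ x
  -- On the cone `|x - y| < 2|x - y₀|`, so `6R ≤ |y - y₀| < 3|x - y₀|`. This is what the Hölder
  -- condition requires for points within `R` of `y₀`.
  have hxy : 2 * R ≤ dist x y₀ := by linarith
  have hint := hS.integrableOn hE hK₁ (by positivity) hβ hA hμA hx.1 (μ := μ)
  have hfin := isFiniteMeasure_restrict_inter (E := E) hμA
  have hmeas : μ.real (A ∩ E) = μ.real A := by
    refine measureReal_congr ?_
    filter_upwards [hμE] with z hz
    exact propext ⟨fun h => h.1, fun h => ⟨h, hz⟩⟩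
  -- Cancellation: `a = c μ(A)`, and `A` and `A ∩ E` have the same measure.
  have heq : a * S x y₀ - c * kernelMean E S μ A x =
      c * ∫ z in A ∩ E, (S x y₀ - S x z) ∂μ := by
    rw [integral_sub (integrable_const _) hint, setIntegral_const, hmeas, hac, kernelMean]
    simp only [Complex.real_smul]
    ring
  have hb : ‖∫ z in A ∩ E, (S x y₀ - S x z) ∂μ‖ ≤
      K₂ * R ^ β * dist x y₀ ^ (-(m + β + α)) * μ.real (A ∩ E) := by
    refine norm_setIntegral_le_of_norm_le_const
      ((measure_mono inter_subset_left).trans_lt hμA.lt_top) fun z hz => ?_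
    have hz1 : dist y₀ z ≤ R := by rw [dist_comm]; exact (Metric.mem_ball.1 (hAR hz.1)).le
    refine (hS.holder x hx.1 y₀ hy₀ z hz.2 (by linarith)).trans ?_
    rw [div_eq_mul_inv, ← Real.rpow_neg dist_nonneg, ← mul_assoc, add_right_comm]
    gcongr
  rw [heq, norm_mul, hac, norm_mul, Complex.norm_real, Real.norm_of_nonneg measureReal_nonneg]
  rw [hmeas] at hb
  calc ‖c‖ * _ ≤ ‖c‖ * (K₂ * R ^ β * dist x y₀ ^ (-(m + β + α)) * μ.real A) := by gcongr
    _ = _ := by ring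

end Kernel

/-- Cauchy–Schwarz. -/
lemma setLIntegral_le_rpow_mul_eLpNorm {X : Type*} [MeasurableSpace X] {μ : Measure X}
    {f : X → ℝ≥0∞} (hf : Measurable f) (s : Set X) :
    ∫⁻ x in s, f x ∂μ ≤ eLpNorm f 2 μ * μ s ^ (1 / 2 : ℝ) := by
  have h1 := eLpNorm_le_eLpNorm_mul_rpow_measure_univ (μ := μ.restrict s) (p := 1) (q := 2)
    (by norm_num) hf.aestronglyMeasurable
  rw [eLpNorm_one_eq_lintegral_enorm] at h1
  simp only [enorm_eq_self, Measure.restrict_apply_univ] at h1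
  have e : 1 / (1 : ℝ≥0∞).toReal - 1 / (2 : ℝ≥0∞).toReal = 1 / 2 := by norm_num
  rw [e] at h1
  refine h1.trans ?_
  gcongr
  exact Measure.restrict_le_self

/-! ### The local estimate for an atom minus its spread mass -/

section Local

variable {n : ℕ} {E : Set (EuclideanSpace ℝ (Fin n))} {α β m K₁ K₂ : ℝ}
  {S : EuclideanSpace ℝ (Fin n) → EuclideanSpace ℝ (Fin n) → ℂ}
  {μ : Measure (EuclideanSpace ℝ (Fin n))} {A : Set (EuclideanSpace ℝ (Fin n))}

/-- Cauchy–Schwarz on `B` and the `L²` bound for `c 1_A` give `|c| μ(A)^(1/2) μ(B)^(1/2)`.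
Comparability of `μ(B)` with `μ(A)` turns this into a multiple of `|c| μ(A) = |a|`. -/
lemma IsKernel.setLIntegral_squareFun_indicator_le (hE : IsClosed E)
    (hS : IsKernel E α β m K₁ K₂ S)
    (hK₁ : 0 < K₁) (hmα : 0 ≤ m + α) (hβ : 0 < β) {N : ℝ≥0} (hN : BoundedL2 E α S μ N)
    {a c : ℂ} (hA : MeasurableSet A) (hμA : μ A ≠ ∞) (hac : a = c * μ.real A)
    {D : ℝ≥0∞} {B : Set (EuclideanSpace ℝ (Fin n))} (hB : μ B ≤ D * μ A) :
    ∫⁻ y in B, conicalIntegral E α (fun x => c * kernelMean E S μ A x) y ∂μ ≤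
      ‖a‖ₑ * (N * D ^ (1 / 2 : ℝ)) := by
  have hcong : ∀ y, conicalIntegral E α (fun x => c * kernelMean E S μ A x) y =
      squareFun E α S μ (A.indicator fun _ => c) y := fun y =>
    conicalIntegral_congr hE α (fun x hx => (hS.opT_indicator hE hK₁ hmα hβ c hA hμA hx).symm) y
  simp_rw [hcong]
  have hmem : MemLp (A.indicator fun _ => c) 2 μ := memLp_indicator_const 2 hA c (Or.inr hμA)
  have ha : ‖a‖ₑ = ‖c‖ₑ * μ A := by
    rw [hac, enorm_mul, ← ofReal_norm (μ.real A : ℂ), Complex.norm_real,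
      Real.norm_of_nonneg measureReal_nonneg, ofReal_measureReal hμA]
  calc _ ≤ eLpNorm (squareFun E α S μ (A.indicator fun _ => c)) 2 μ * μ B ^ (1 / 2 : ℝ) :=
        setLIntegral_le_rpow_mul_eLpNorm (measurable_conicalIntegral hE α _) B
    _ ≤ N * (‖c‖ₑ * μ A ^ (1 / 2 : ℝ)) * (D * μ A) ^ (1 / 2 : ℝ) := by
        gcongr
        refine (hN _ hmem).trans ?_
        gcongr
        rw [eLpNorm_indicator_const hA (by norm_num) (by norm_num)]
        norm_num
    _ = ‖c‖ₑ * (μ A ^ (1 / 2 : ℝ) * μ A ^ (1 / 2 : ℝ)) * (N * D ^ (1 / 2 : ℝ)) := by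
        rw [ENNReal.mul_rpow_of_nonneg _ _ (by norm_num)]; ring
    _ = _ := by
        rw [← ENNReal.rpow_add_of_nonneg _ _ (by norm_num) (by norm_num), ha]
        norm_num

/-- The constant in the local `L¹` estimate. -/
noncomputable def localConst (n : ℕ) (α β m K₁ K₂ c₀ : ℝ) (N : ℝ≥0) : ℝ≥0∞ :=
  ENNReal.ofReal K₁ * coneConst n m α ^ (1 / 2 : ℝ) *
      (ENNReal.ofReal (3 * 16 ^ m) * ENNReal.ofReal c₀) +
    N * (2 * ENNReal.ofReal (16 ^ (m + 1))) ^ (1 / 2 : ℝ) +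
    ENNReal.ofReal K₂ * coneConst n (m + β) α ^ (1 / 2 : ℝ) *
      (ENNReal.ofReal (radialConst m β) * ENNReal.ofReal c₀)

lemma localConst_ne_top (n : ℕ) (α β m K₁ K₂ c₀ : ℝ) (N : ℝ≥0) :
    localConst n α β m K₁ K₂ c₀ N ≠ ∞ := by
  have h1 := ENNReal.rpow_ne_top_of_nonneg (by norm_num : (0 : ℝ) ≤ 1 / 2) (coneConst_ne_top n m α)
  have h2 := ENNReal.rpow_ne_top_of_nonneg (by norm_num : (0 : ℝ) ≤ 1 / 2)
    (coneConst_ne_top n (m + β) α)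
  unfold localConst
  finiteness

/-- Up to the doubling radius the annulus estimate applies, and its last term is controlled by
growth; one further annulus, up to 16 times that radius, costs only the growth constant. The bound
does not depend on `l`. -/
lemma lintegral_dist_rpow_near_stopping_le {X : Type*} [PseudoMetricSpace X] [MeasurableSpace X]
    [OpensMeasurableSpace X] {μ : Measure X} {y₀ : X} {C : ℝ≥0∞} (hm : 0 < m)
    {r : ℝ} (hr : 0 < r) (l : ℕ)
    (h : ∀ r : ℝ, 0 < r → μ (Metric.ball y₀ r) ≤ C * ENNReal.ofReal (r ^ m))
    (hnd : ∀ j, 1 ≤ j → j < l + 1 →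
      ENNReal.ofReal (16 ^ (m + 1)) * μ (Metric.ball y₀ (16 ^ j * r)) ≤
        μ (Metric.ball y₀ (16 ^ (j + 1) * r))) :
    ∫⁻ y in {y | r ≤ dist y y₀ ∧ dist y y₀ < 16 * (16 ^ (l + 1) * r)},
      ENNReal.ofReal (dist y y₀ ^ (-m)) ∂μ ≤ ENNReal.ofReal (3 * 16 ^ m) * C := by
  have hcont : Continuous fun y => dist y y₀ := by fun_prop
  have hR : 0 < (16 : ℝ) ^ (l + 1) * r := by positivity
  set R := (16 : ℝ) ^ (l + 1) * r with hRdef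
  have hsub : {y | r ≤ dist y y₀ ∧ dist y y₀ < 16 * R} ⊆
      {y | r ≤ dist y y₀ ∧ dist y y₀ < R} ∪ {y | R ≤ dist y y₀ ∧ dist y y₀ < 16 * R} := by
    intro y hy
    rcases lt_or_ge (dist y y₀) R with h1 | h1
    · exact Or.inl ⟨hy.1, h1⟩
    · exact Or.inr ⟨h1, hy.2⟩
  refine (lintegral_mono_set hsub).trans ((lintegral_union_le _ _ _).trans ?_)
  have e : R ^ (-m) * R ^ m = 1 := by rw [← Real.rpow_add hR]; simp
  have h1 : ∫⁻ y in {y | r ≤ dist y y₀ ∧ dist y y₀ < R}, ENNReal.ofReal (dist y y₀ ^ (-m)) ∂μ ≤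
      ENNReal.ofReal (2 * 16 ^ m) * C := by
    refine (lintegral_dist_rpow_annulus_le hm hr l hnd).trans ?_
    refine (mul_le_mul_right (h R hR) _).trans_eq ?_
    rw [mul_left_comm, ← ENNReal.ofReal_mul (by positivity), mul_assoc, e, mul_one, mul_comm]
  have h2 : ∫⁻ y in {y | R ≤ dist y y₀ ∧ dist y y₀ < 16 * R},
      ENNReal.ofReal (dist y y₀ ^ (-m)) ∂μ ≤ ENNReal.ofReal (16 ^ m) * C := by
    refine (setLIntegral_le_of_le_on (t := Metric.ball y₀ (16 * R)) (fun x hx => hx.2)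
      ((measurableSet_le measurable_const hcont.measurable).inter
      (measurableSet_lt hcont.measurable measurable_const))
      (fun x hx => ENNReal.ofReal_le_ofReal (rpow_neg_le_of_le hR hx.1 hm.le))
      (h _ (by positivity))).trans_eq ?_
    rw [mul_left_comm, ← ENNReal.ofReal_mul (by positivity), Real.mul_rpow (by norm_num) hR.le,
      mul_left_comm, e, mul_one, mul_comm]
  refine (add_le_add h1 h2).trans_eq ?_
  rw [← add_mul, ← ENNReal.ofReal_add (by positivity) (by positivity)]
  congr 2; ring

/-- The local `L¹` estimate, away from the stopping ball. -/
lemma IsKernel.setLIntegral_conicalIntegral_sub_le (hE : IsClosed E)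
    (hS : IsKernel E α β m K₁ K₂ S)
    (hK₁ : 0 < K₁) (hK₂ : 0 < K₂) (hm : 0 < m) (hα : 0 < α) (hβ : 0 < β)
    {c₀ : ℝ} {N : ℝ≥0} (hN : BoundedL2 E α S μ N)
    (hμE : ∀ᵐ z ∂μ, z ∈ E) {a c : ℂ} {y₀ : EuclideanSpace ℝ (Fin n)} (hy₀ : y₀ ∈ E)
    (h : ∀ r : ℝ, 0 < r → μ (Metric.ball y₀ r) ≤ ENNReal.ofReal c₀ * ENNReal.ofReal (r ^ m))
    {r : ℝ} (hr : 0 < r) (l : ℕ)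
    (hd : μ (Metric.ball y₀ (16 * (16 ^ (l + 1) * r))) ≤
        ENNReal.ofReal (16 ^ (m + 1)) * μ (Metric.ball y₀ (16 ^ (l + 1) * r)))
    (hnd : ∀ j, 1 ≤ j → j < l + 1 →
      ENNReal.ofReal (16 ^ (m + 1)) * μ (Metric.ball y₀ (16 ^ j * r)) ≤
        μ (Metric.ball y₀ (16 ^ (j + 1) * r)))
    (hA : MeasurableSet A) (hAR : A ⊆ Metric.ball y₀ (16 ^ (l + 1) * r))
    (hhalf : μ (Metric.ball y₀ (16 ^ (l + 1) * r)) ≤ 2 * μ A) (hac : a = c * μ.real A) :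
    ∫⁻ y in E ∩ {y | r ≤ dist y y₀},
        conicalIntegral E α (fun x => a * S x y₀ - c * kernelMean E S μ A x) y ∂μ ≤
      ‖a‖ₑ * localConst n α β m K₁ K₂ c₀ N := by
  have hcont : Continuous fun y : EuclideanSpace ℝ (Fin n) => dist y y₀ := by fun_prop
  have hR : 0 < (16 : ℝ) ^ (l + 1) * r := by positivity
  have hnear := lintegral_dist_rpow_near_stopping_le hm hr l h hnd
  set R := (16 : ℝ) ^ (l + 1) * r with hRdef
  have hμA : μ A ≠ ∞ := ne_top_of_le_ne_top
    (ne_top_of_le_ne_top (by finiteness) (h R hR)) (measure_mono hAR)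
  set G := conicalIntegral E α (fun x => a * S x y₀ - c * kernelMean E S μ A x) with hG
  set near : Set (EuclideanSpace ℝ (Fin n)) := {y | r ≤ dist y y₀ ∧ dist y y₀ < 16 * R}
  set far : Set (EuclideanSpace ℝ (Fin n)) := {y | 16 * R ≤ dist y y₀}
  have hnearm : MeasurableSet near := (measurableSet_le measurable_const hcont.measurable).inter
    (measurableSet_lt hcont.measurable measurable_const)
  have hfarm : MeasurableSet far := measurableSet_le measurable_const hcont.measurable
  have hsub : E ∩ {y | r ≤ dist y y₀} ⊆ (E ∩ near) ∪ (E ∩ far) := by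
    rintro y ⟨hyE, hy⟩
    rcases lt_or_ge (dist y y₀) (16 * R) with h1 | h1
    · exact Or.inl ⟨hyE, hy, h1⟩
    · exact Or.inr ⟨hyE, h1⟩
  refine (lintegral_mono_set hsub).trans ((lintegral_union_le _ _ _).trans ?_)
  have hmα : 0 ≤ m + α := by positivity
  have hSm : AEStronglyMeasurable (fun x => a * S x y₀) (volume.restrict Eᶜ) :=
    (hS.measurable y₀ hy₀).const_mul a
  have hIm : AEStronglyMeasurable (fun x => -(c * kernelMean E S μ A x)) (volume.restrict Eᶜ) :=
    ((hS.aestronglyMeasurable_kernelMean hE hK₁ hmα hβ hA hμA).const_mul c).neg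
  -- Near the ball no cancellation is used: the atom and the spread mass are estimated separately.
  have hsplit : ∀ y, G y ≤ conicalIntegral E α (fun x => a * S x y₀) y +
      conicalIntegral E α (fun x => c * kernelMean E S μ A x) y := by
    intro y
    have h1 := conicalIntegral_add_le α hSm hIm y
    have h2 : conicalIntegral E α (fun x => -(c * kernelMean E S μ A x)) y =
        conicalIntegral E α (fun x => c * kernelMean E S μ A x) y := by
      simp only [conicalIntegral, enorm_neg]
    rw [h2] at h1
    refine le_trans (le_of_eq ?_) h1
    rw [hG]
    congr 1
  have hnear' : ∫⁻ y in E ∩ near, G y ∂μ ≤ ‖a‖ₑ * (ENNReal.ofReal K₁ *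
      coneConst n m α ^ (1 / 2 : ℝ) * (ENNReal.ofReal (3 * 16 ^ m) * ENNReal.ofReal c₀)) +
      ‖a‖ₑ * (N * (2 * ENNReal.ofReal (16 ^ (m + 1))) ^ (1 / 2 : ℝ)) := by
    calc ∫⁻ y in E ∩ near, G y ∂μ ≤ ∫⁻ y in E ∩ near,
          (conicalIntegral E α (fun x => a * S x y₀) y +
            conicalIntegral E α (fun x => c * kernelMean E S μ A x) y) ∂μ :=
          lintegral_mono fun y => hsplit y
      _ = ∫⁻ y in E ∩ near, conicalIntegral E α (fun x => a * S x y₀) y ∂μ +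
          ∫⁻ y in E ∩ near, conicalIntegral E α (fun x => c * kernelMean E S μ A x) y ∂μ :=
          lintegral_add_left (measurable_conicalIntegral hE α _) _
      _ ≤ _ := by
        gcongr
        · have hc := ENNReal.rpow_ne_top_of_nonneg (by norm_num : (0 : ℝ) ≤ 1 / 2)
            (coneConst_ne_top n m α)
          calc _ ≤ ∫⁻ y in E ∩ near, ‖a‖ₑ * ENNReal.ofReal K₁ * coneConst n m α ^ (1 / 2 : ℝ) *
                ENNReal.ofReal (dist y y₀ ^ (-m)) ∂μ := by
                refine setLIntegral_mono_ae' (hE.measurableSet.inter hnearm)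
                  (.of_forall fun y hy => ?_)
                exact hS.conicalIntegral_le hE hK₁ hm hα a hy.1 hy₀ (hr.trans_le hy.2.1)
            _ = ‖a‖ₑ * ENNReal.ofReal K₁ * coneConst n m α ^ (1 / 2 : ℝ) *
                ∫⁻ y in E ∩ near, ENNReal.ofReal (dist y y₀ ^ (-m)) ∂μ :=
                lintegral_const_mul' _ _ (by finiteness)
            _ ≤ ‖a‖ₑ * ENNReal.ofReal K₁ * coneConst n m α ^ (1 / 2 : ℝ) *
                (ENNReal.ofReal (3 * 16 ^ m) * ENNReal.ofReal c₀) := by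
                gcongr
                exact (lintegral_mono_set inter_subset_right).trans hnear
            _ = _ := by ring
        -- The doubling inequality and the half-measure property of `A` together make `μ(B(y₀,
        -- 16R))` comparable to `μ(A)`.
        · refine hS.setLIntegral_squareFun_indicator_le hE hK₁ hmα hβ hN hA hμA hac ?_
          calc μ (E ∩ near) ≤ μ (Metric.ball y₀ (16 * R)) := measure_mono fun y hy => hy.2.2
            _ ≤ ENNReal.ofReal (16 ^ (m + 1)) * (2 * μ A) := by
                refine hd.trans ?_
                gcongr
            _ = _ := by ring
  have hfar' : ∫⁻ y in E ∩ far, G y ∂μ ≤ ‖a‖ₑ * (ENNReal.ofReal K₂ *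
      coneConst n (m + β) α ^ (1 / 2 : ℝ) *
      (ENNReal.ofReal (radialConst m β) * ENNReal.ofReal c₀)) := by
    have hc := ENNReal.rpow_ne_top_of_nonneg (by norm_num : (0 : ℝ) ≤ 1 / 2)
      (coneConst_ne_top n (m + β) α)
    calc _ ≤ ∫⁻ y in E ∩ far, ‖a‖ₑ * ENNReal.ofReal (K₂ * R ^ β) *
          coneConst n (m + β) α ^ (1 / 2 : ℝ) * ENNReal.ofReal (dist y y₀ ^ (-(m + β))) ∂μ := by
          refine setLIntegral_mono_ae' (hE.measurableSet.inter hfarm) (.of_forall fun y hy => ?_)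
          have hy2 : 16 * R ≤ dist y y₀ := hy.2
          exact hS.conicalIntegral_sub_le hE hK₁ hK₂ hm hα hβ hμE hR hA hμA hAR hac hy.1 hy₀
            (by linarith)
      _ = ‖a‖ₑ * ENNReal.ofReal (K₂ * R ^ β) * coneConst n (m + β) α ^ (1 / 2 : ℝ) *
          ∫⁻ y in E ∩ far, ENNReal.ofReal (dist y y₀ ^ (-(m + β))) ∂μ :=
          lintegral_const_mul' _ _ (by finiteness)
      _ ≤ ‖a‖ₑ * ENNReal.ofReal (K₂ * R ^ β) * coneConst n (m + β) α ^ (1 / 2 : ℝ) *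
          (ENNReal.ofReal (radialConst m β * R ^ (-β)) * ENNReal.ofReal c₀) := by
          gcongr
          calc _ ≤ ∫⁻ y in {y | R ≤ dist y y₀}, ENNReal.ofReal (dist y y₀ ^ (-(m + β))) ∂μ :=
                lintegral_mono_set fun y hy => by
                  have hy2 : 16 * R ≤ dist y y₀ := hy.2
                  change R ≤ dist y y₀
                  linarith
            _ ≤ _ := lintegral_dist_rpow_far_le hm.le hβ hR h
      _ = _ := by
          have k := radialConst_pos (a := m) hβ
          have e : ENNReal.ofReal (R ^ β) * ENNReal.ofReal (R ^ (-β)) = 1 := by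
            rw [← ENNReal.ofReal_mul (by positivity), ← Real.rpow_add hR]; simp
          rw [ENNReal.ofReal_mul hK₂.le, ENNReal.ofReal_mul k.le]
          calc _ = ‖a‖ₑ * (ENNReal.ofReal K₂ * coneConst n (m + β) α ^ (1 / 2 : ℝ) *
              (ENNReal.ofReal (radialConst m β) * ENNReal.ofReal c₀)) *
              (ENNReal.ofReal (R ^ β) * ENNReal.ofReal (R ^ (-β))) := by ring
            _ = _ := by rw [e, mul_one]
  refine (add_le_add hnear' hfar').trans_eq ?_
  rw [localConst]
  ring

end Local

lemma eLpNorm_two_sq_eq_lintegral {X Y : Type*} [MeasurableSpace X] [TopologicalSpace Y]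
    [ContinuousENorm Y] {μ : Measure X} (f : X → Y) :
    eLpNorm f 2 μ ^ 2 = ∫⁻ x, ‖f x‖ₑ ^ 2 ∂μ := by
  have h := eLpNorm_nnreal_pow_eq_lintegral (f := f) (μ := μ) (p := 2) (by norm_num)
  simpa using h

/-- A finite combination of point masses, as a measure. -/
noncomputable def atomicMeasure {X : Type*} [MeasurableSpace X] (F : Finset X) (w : X → ℝ≥0∞) :
    Measure X := ∑ y ∈ F, w y • Measure.dirac y

lemma sum_le_atomicMeasure {X : Type*} [MeasurableSpace X] {F G : Finset X}
    {w : X → ℝ≥0∞} {s : Set X} (hs : MeasurableSet s) (hG : G ⊆ F) (hGs : ∀ y ∈ G, y ∈ s) :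
    ∑ y ∈ G, w y ≤ atomicMeasure F w s := by
  rw [atomicMeasure, Measure.finsetSum_apply]
  refine le_trans (Finset.sum_le_sum fun y hy => ?_) (Finset.sum_le_sum_of_subset hG)
  simp [Measure.dirac_apply' y hs, hGs y hy]

lemma atomicMeasure_univ {X : Type*} [MeasurableSpace X] (F : Finset X) (w : X → ℝ≥0∞) :
    atomicMeasure F w univ = ∑ y ∈ F, w y := by
  simp [atomicMeasure, Measure.finsetSum_apply]

/-! ### The decomposition at a given level -/

section Selection

variable {X : Type*} [PseudoMetricSpace X] [MeasurableSpace X] [OpensMeasurableSpace X]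

/-- Calderón–Zygmund decomposition of a finite combination of point masses at level `t`, with
respect to a measure with polynomial growth. -/
lemma exists_calderonZygmund {μ : Measure X} {F : Finset X} {w : X → ℝ≥0∞} {t C : ℝ≥0∞} {m : ℝ}
    (hm : 0 < m) (hC : C ≠ ∞) (ht0 : t ≠ 0) (ht : t ≠ ∞) (hw : ∀ y ∈ F, w y ≠ 0)
    (h : ∀ y ∈ F, ∀ r : ℝ, 0 < r → μ (Metric.ball y r) ≤ C * ENNReal.ofReal (r ^ m))
    (hV : ∑ y ∈ F, w y < t * μ univ) :
    ∃ (r : X → ℝ) (l : X → ℕ) (A : X → Set X),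
      (∀ y ∈ F, 0 < r y ∧
        μ (Metric.ball y (16 * (16 ^ (l y + 1) * r y))) ≤
          ENNReal.ofReal (16 ^ (m + 1)) * μ (Metric.ball y (16 ^ (l y + 1) * r y)) ∧
        (∀ j, 1 ≤ j → j < l y + 1 →
          ENNReal.ofReal (16 ^ (m + 1)) * μ (Metric.ball y (16 ^ j * r y)) ≤
            μ (Metric.ball y (16 ^ (j + 1) * r y))) ∧
        MeasurableSet (A y) ∧ A y ⊆ Metric.ball y (16 ^ (l y + 1) * r y) ∧
        μ (Metric.ball y (16 ^ (l y + 1) * r y)) ≤ 2 * μ (A y) ∧ μ (A y) ≠ 0 ∧ μ (A y) ≠ ∞) ∧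
      t * μ (⋃ y ∈ F, Metric.ball y (3 * r y)) ≤ ∑ y ∈ F, w y ∧
      ∀ z, ∑ y ∈ F, (A y).indicator (fun _ => w y / μ (A y)) z ≤
        4 * (t * ENNReal.ofReal (16 ^ (m + 1))) := by
  set ω := atomicMeasure F w with hω
  have hball : ∀ (y : X) (r : ℝ), MeasurableSet (Metric.ball y r) := fun y r =>
    Metric.isOpen_ball.measurableSet
  have hωy : ∀ y ∈ F, ∀ r : ℝ, 0 < r → w y ≤ ω (Metric.ball y r) := fun y hy r hr => by
    simpa using sum_le_atomicMeasure (F := F) (G := {y}) (w := w) (hball y r) (by simpa using hy)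
      (fun z hz => by rw [Finset.mem_singleton.1 hz]; exact Metric.mem_ball_self hr)
  have hscale : ∀ y, ∃ r : ℝ, y ∈ F → 0 < r ∧
      t * μ (Metric.ball y (16 * r)) < ω (Metric.ball y (3 * r)) ∧ ∀ j : ℕ, 1 ≤ j →
        ω (Metric.ball y (3 * (16 ^ j * r))) ≤ t * μ (Metric.ball y (16 * (16 ^ j * r))) := by
    intro y
    by_cases hy : y ∈ F
    · obtain ⟨r, hr⟩ := exists_stopping_scale (ω := ω) hm hC ht (h y hy)
        ⟨w y, pos_iff_ne_zero.2 (hw y hy), hωy y hy⟩ (by rwa [hω, atomicMeasure_univ])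
      exact ⟨r, fun _ => hr⟩
    · exact ⟨0, fun h => absurd h hy⟩
  choose r hr using hscale
  have hdoub : ∀ y, ∃ l : ℕ, y ∈ F → μ (Metric.ball y (16 * (16 ^ (l + 1) * r y))) ≤
        ENNReal.ofReal (16 ^ (m + 1)) * μ (Metric.ball y (16 ^ (l + 1) * r y)) ∧
      ∀ j, 1 ≤ j → j < l + 1 →
        ENNReal.ofReal (16 ^ (m + 1)) * μ (Metric.ball y (16 ^ j * r y)) ≤
          μ (Metric.ball y (16 ^ (j + 1) * r y)) := by
    intro y
    by_cases hy : y ∈ F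
    · obtain ⟨hr0, -, hr2⟩ := hr y hy
      -- The first scale after stopping already carries the atom, so the reverse inequality there
      -- forces the `μ`-ball to have positive measure.
      have h1 := (hωy y hy _ (by positivity)).trans (hr2 1 le_rfl)
      have hpos : 0 < μ (Metric.ball y (16 * (16 * r y))) := by
        rw [pos_iff_ne_zero]
        intro h0
        rw [pow_one, h0, mul_zero] at h1
        exact hw y hy (le_antisymm h1 zero_le)
      obtain ⟨l, hl⟩ := exists_doubling_scale hC hr0 (h y hy) hpos
      exact ⟨l, fun _ => hl⟩
    · exact ⟨0, fun h => absurd h hy⟩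
  choose l hl using hdoub
  set D := ENNReal.ofReal (16 ^ (m + 1)) with hD
  have hD0 : D ≠ 0 := by rw [hD]; simp; positivity
  have hM0 : t * D ≠ 0 := mul_ne_zero ht0 hD0
  have hMt : t * D ≠ ∞ := ENNReal.mul_ne_top ht ENNReal.ofReal_ne_top
  set R : X → ℝ := fun y => 16 ^ (l y + 1) * r y with hR
  have hR0 : ∀ y ∈ F, 0 < R y := fun y hy => by have := (hr y hy).1; positivity
  have hμt : ∀ y ∈ F, μ (Metric.ball y (R y)) ≠ ∞ := fun y hy =>
    ne_top_of_le_ne_top (by finiteness) (h y hy _ (hR0 y hy))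
  -- The radius `R y` lies beyond the stopping scale because `l y + 1 ≥ 1`; hence `ω(B(y, 3R)) ≤ t
  -- μ(B(y, 16R))`, and doubling returns from `16R` to `R`.
  have hsum : ∀ y ∈ F, ∀ G ⊆ F, (∀ s ∈ G, s ∈ Metric.ball y (3 * R y)) →
      ∑ s ∈ G, w s ≤ t * D * μ (Metric.ball y (R y)) := by
    intro y hy G hG hGs
    refine (sum_le_atomicMeasure (hball _ _) hG hGs).trans
      (((hr y hy).2.2 (l y + 1) (by omega)).trans ?_)
    rw [mul_assoc]
    gcongr
    exact (hl y hy).1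
  have hμ0 : ∀ y ∈ F, μ (Metric.ball y (R y)) ≠ 0 := fun y hy h0 => by
    have h1 := hsum y hy {y} (by simpa using hy) (by simpa using hR0 y hy)
    rw [h0, mul_zero, Finset.sum_singleton] at h1
    exact hw y hy (le_antisymm h1 zero_le)
  obtain ⟨A, hA, hdens⟩ := exists_density_selection F R w hM0 hMt hμ0 hμt hsum
  refine ⟨r, l, A, fun y hy => ⟨(hr y hy).1, (hl y hy).1, (hl y hy).2, (hA y hy).1, (hA y hy).2.1,
    (hA y hy).2.2, fun h0 => ?_, ne_top_of_le_ne_top (hμt y hy) (measure_mono (hA y hy).2.1)⟩,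
    ?_, hdens⟩
  · have := (hA y hy).2.2
    rw [h0, mul_zero] at this
    exact hμ0 y hy (le_antisymm this zero_le)
  · rw [← atomicMeasure_univ F w]
    exact measure_biUnion_ball_le F r (fun y hy => (hr y hy).1) fun y hy => (hr y hy).2.1.le

end Selection

/-! ### The weak type estimate for point masses -/

section Atomic

variable {n : ℕ} {E : Set (EuclideanSpace ℝ (Fin n))} {α β m K₁ K₂ c₀ : ℝ}
  {S : EuclideanSpace ℝ (Fin n) → EuclideanSpace ℝ (Fin n) → ℂ}
  {μ : Measure (EuclideanSpace ℝ (Fin n))}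

lemma IsOfOrder.ae_mem (hμ : IsOfOrder E m c₀ μ) : ∀ᵐ z ∂μ, z ∈ E := by
  have : μ μ.supportᶜ = 0 := Measure.measure_compl_support
  exact measure_mono_null (compl_subset_compl.2 hμ.support_subset) this

lemma IsOfOrder.measure_ball_le (hμ : IsOfOrder E m c₀ μ) {y : EuclideanSpace ℝ (Fin n)}
    (hy : y ∈ E) (r : ℝ) (hr : 0 < r) :
    μ (Metric.ball y r) ≤ ENNReal.ofReal c₀ * ENNReal.ofReal (r ^ m) := by
  rw [← ENNReal.ofReal_mul' (by positivity)]
  exact hμ.ball_le y hy r hr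

/-- The constant in the weak type estimate. -/
noncomputable def weakTypeConst (n : ℕ) (α β m K₁ K₂ c₀ : ℝ) (N : ℝ≥0) : ℝ≥0∞ :=
  1 + 16 * N ^ 2 * ENNReal.ofReal (16 ^ (m + 1)) + 2 * localConst n α β m K₁ K₂ c₀ N

lemma weakTypeConst_ne_top (n : ℕ) (α β m K₁ K₂ c₀ : ℝ) (N : ℝ≥0) :
    weakTypeConst n α β m K₁ K₂ c₀ N ≠ ∞ := by
  have := localConst_ne_top n α β m K₁ K₂ c₀ N
  unfold weakTypeConst
  finiteness

/-- The good part of the decomposition. -/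
lemma mul_measure_squareFun_le (hE : IsClosed E) {N : ℝ≥0} (hN : BoundedL2 E α S μ N)
    {t M V : ℝ≥0∞} (ht0 : t ≠ 0) (ht : t ≠ ∞) {g : EuclideanSpace ℝ (Fin n) → ℂ}
    (hg : AEStronglyMeasurable g μ) (hgM : ∀ z, ‖g z‖ₑ ≤ 4 * (t * M)) (hM : M ≠ ∞)
    (hgV : ∫⁻ z, ‖g z‖ₑ ∂μ ≤ V) (hV : V ≠ ∞) :
    t * μ {y | t / 2 ≤ squareFun E α S μ g y} ≤ 16 * N ^ 2 * M * V := by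
  -- Interpolation between `L^∞` and `L¹`. The single factor `t` gained here cancels one of the two
  -- lost in Chebyshev's inequality for the square.
  have hsq : eLpNorm g 2 μ ^ 2 ≤ 4 * (t * M) * V := by
    rw [eLpNorm_two_sq_eq_lintegral]
    calc ∫⁻ z, ‖g z‖ₑ ^ 2 ∂μ ≤ ∫⁻ z, 4 * (t * M) * ‖g z‖ₑ ∂μ := lintegral_mono fun z => by
          rw [sq]; gcongr; exact hgM z
      _ = 4 * (t * M) * ∫⁻ z, ‖g z‖ₑ ∂μ := lintegral_const_mul' _ _ (by finiteness)
      _ ≤ _ := by gcongr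
  have hmem : MemLp g 2 μ := by
    refine ⟨hg, ?_⟩
    by_contra htop
    rw [not_lt, top_le_iff] at htop
    rw [htop] at hsq
    simp only [ne_eq, OfNat.ofNat_ne_zero, not_false_eq_true, ENNReal.top_pow, top_le_iff] at hsq
    exact (by finiteness : 4 * (t * M) * V ≠ ∞) hsq
  have hmeas := measurable_conicalIntegral hE α (opT E S μ g)
  have hcheb := mul_meas_ge_le_lintegral (μ := μ) (hmeas.pow_const 2) ((t / 2) ^ 2)
  have hset : {y | t / 2 ≤ squareFun E α S μ g y} ⊆
      {y | (t / 2) ^ 2 ≤ conicalIntegral E α (opT E S μ g) y ^ 2} := fun y hy => by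
    have hy' : t / 2 ≤ squareFun E α S μ g y := hy
    change _ ≤ squareFun E α S μ g y ^ 2
    gcongr
  have hint : ∫⁻ y, conicalIntegral E α (opT E S μ g) y ^ 2 ∂μ ≤ N ^ 2 * (4 * (t * M) * V) := by
    have h1 := eLpNorm_two_sq_eq_lintegral (μ := μ) (squareFun E α S μ g)
    simp only [enorm_eq_self] at h1
    change ∫⁻ y, squareFun E α S μ g y ^ 2 ∂μ ≤ _
    rw [← h1]
    calc eLpNorm (squareFun E α S μ g) 2 μ ^ 2 ≤ (N * eLpNorm g 2 μ) ^ 2 := by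
          gcongr; exact hN g hmem
      _ = N ^ 2 * eLpNorm g 2 μ ^ 2 := mul_pow _ _ _
      _ ≤ _ := by gcongr
  have key : (t / 2) ^ 2 * μ {y | t / 2 ≤ squareFun E α S μ g y} ≤ N ^ 2 * (4 * (t * M) * V) :=
    (mul_le_mul_right (measure_mono hset) _).trans (hcheb.trans hint)
  have h2 : 4 * (t / 2) ^ 2 = t * t := by
    rw [div_eq_mul_inv, mul_pow, ← mul_assoc, mul_comm 4, mul_assoc, sq 2⁻¹]
    have : (4 : ℝ≥0∞) = 2 * 2 := by norm_num
    rw [this, mul_mul_mul_comm, ENNReal.mul_inv_cancel (by norm_num) (by norm_num)]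
    ring
  have h3 : t * (t * μ {y | t / 2 ≤ squareFun E α S μ g y}) ≤ t * (16 * N ^ 2 * M * V) := by
    calc t * (t * μ {y | t / 2 ≤ squareFun E α S μ g y})
        = 4 * ((t / 2) ^ 2 * μ {y | t / 2 ≤ squareFun E α S μ g y}) := by
          rw [← mul_assoc, ← mul_assoc, h2]
      _ ≤ 4 * (N ^ 2 * (4 * (t * M) * V)) := by gcongr
      _ = _ := by ring
  exact (ENNReal.mul_le_mul_iff_right ht0 ht).1 h3

/-- The three terms of `weakTypeConst` account for the exceptional union of balls, the good part and
the bad part. Nonzero coefficients are required so that each atom has a stopping scale. -/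
lemma IsKernel.weakType_atomic_of_ne_zero (hE : IsClosed E) (hS : IsKernel E α β m K₁ K₂ S)
    (hK₁ : 0 < K₁) (hK₂ : 0 < K₂) (hm : 0 < m) (hα : 0 < α) (hβ : 0 < β)
    {N : ℝ≥0} (hμ : IsOfOrder E m c₀ μ) (hN : BoundedL2 E α S μ N)
    {F : Finset (EuclideanSpace ℝ (Fin n))} (hF : ∀ y ∈ F, y ∈ E)
    {a : EuclideanSpace ℝ (Fin n) → ℂ} (ha : ∀ y ∈ F, a y ≠ 0) {t : ℝ≥0∞} (ht0 : t ≠ 0)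
    (ht : t ≠ ∞) :
    t * μ {y ∈ E | t < conicalIntegral E α (fun x => ∑ z ∈ F, a z * S x z) y} ≤
      weakTypeConst n α β m K₁ K₂ c₀ N * ∑ y ∈ F, ‖a y‖ₑ := by
  set V := ∑ y ∈ F, ‖a y‖ₑ with hV
  have hVt : V ≠ ∞ := ENNReal.sum_ne_top.2 fun y _ => enorm_ne_top
  -- A stopping scale exists only if the mass of `ω` is below `t * μ univ`; otherwise the summand 1
  -- of the constant suffices.
  rcases le_or_gt (t * μ univ) V with htriv | hlt
  · calc t * μ _ ≤ t * μ univ := by gcongr; exact subset_univ _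
      _ ≤ 1 * V := by rwa [one_mul]
      _ ≤ _ := by
        gcongr
        rw [weakTypeConst, add_assoc]
        exact le_self_add
  have hμE := hμ.ae_mem
  have hmα : 0 ≤ m + α := by positivity
  obtain ⟨r, l, A, hA, hΩ, hdens⟩ := exists_calderonZygmund hm ENNReal.ofReal_ne_top ht0 ht
    (w := fun y => ‖a y‖ₑ) (fun y hy => by simpa using ha y hy)
    (fun y hy => hμ.measure_ball_le (hF y hy)) hlt
  set D := ENNReal.ofReal (16 ^ (m + 1)) with hD
  set Ω := ⋃ y ∈ F, Metric.ball y (3 * r y) with hΩdef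
  have hΩm : MeasurableSet Ω := F.measurableSet_biUnion fun y _ => Metric.isOpen_ball.measurableSet
  set c : EuclideanSpace ℝ (Fin n) → ℂ := fun y => a y / μ.real (A y) with hc
  have hpos : ∀ y ∈ F, 0 < μ.real (A y) := fun y hy => by
    obtain ⟨-, -, -, -, -, -, h0, h1⟩ := hA y hy
    exact ENNReal.toReal_pos h0 h1
  have hac : ∀ y ∈ F, a y = c y * μ.real (A y) := fun y hy => by
    have : (μ.real (A y) : ℂ) ≠ 0 := by exact_mod_cast (hpos y hy).ne'
    rw [hc]; field_simp
  have hcn : ∀ y ∈ F, ‖c y‖ₑ = ‖a y‖ₑ / μ (A y) := fun y hy => by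
    obtain ⟨-, -, -, -, -, -, h0, h1⟩ := hA y hy
    rw [ENNReal.eq_div_iff h0 h1, hac y hy, enorm_mul, ← ofReal_norm (μ.real (A y) : ℂ),
      Complex.norm_real, Real.norm_of_nonneg measureReal_nonneg, ofReal_measureReal h1, mul_comm]
  set g : EuclideanSpace ℝ (Fin n) → ℂ :=
    fun z => ∑ y ∈ F, (A y).indicator (fun _ => c y) z with hg
  have hgm : Measurable g := Finset.measurable_fun_sum _ fun y hy =>
    measurable_const.indicator (hA y hy).2.2.2.1
  have hgn : ∀ z, ‖g z‖ₑ ≤ ∑ y ∈ F, (A y).indicator (fun _ => ‖a y‖ₑ / μ (A y)) z := fun z => by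
    refine (enorm_sum_le _ _).trans (Finset.sum_le_sum fun y hy => ?_)
    rw [enorm_indicator_eq_indicator_enorm]
    simp only [hcn y hy]
    exact le_rfl
  have hgV : ∫⁻ z, ‖g z‖ₑ ∂μ ≤ V := by
    refine (lintegral_mono hgn).trans ?_
    rw [lintegral_finsetSum' _ fun y hy =>
      (measurable_const.indicator (hA y hy).2.2.2.1).aemeasurable]
    refine Finset.sum_le_sum fun y hy => ?_
    rw [lintegral_indicator_const (hA y hy).2.2.2.1, mul_comm]
    exact ENNReal.mul_div_le
  have hgood := mul_measure_squareFun_le hE hN ht0 ht hgm.aestronglyMeasurable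
    (fun z => (hgn z).trans (hdens z)) (ENNReal.ofReal_ne_top) hgV hVt
  set b : EuclideanSpace ℝ (Fin n) → EuclideanSpace ℝ (Fin n) → ℂ :=
    fun y x => a y * S x y - c y * kernelMean E S μ (A y) x with hb
  have hIm : ∀ y ∈ F, AEStronglyMeasurable (fun x => c y * kernelMean E S μ (A y) x)
      (volume.restrict Eᶜ) := fun y hy =>
    (hS.aestronglyMeasurable_kernelMean hE hK₁ hmα hβ (hA y hy).2.2.2.1
      (hA y hy).2.2.2.2.2.2.2).const_mul _
  have hbm : ∀ y ∈ F, AEStronglyMeasurable (b y) (volume.restrict Eᶜ) := fun y hy =>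
    ((hS.measurable y (hF y hy)).const_mul _).sub (hIm y hy)
  set H : EuclideanSpace ℝ (Fin n) → ℝ≥0∞ := fun y => ∑ z ∈ F, conicalIntegral E α (b z) y with hH
  have hHm : Measurable H := Finset.measurable_fun_sum _ fun z _ => measurable_conicalIntegral hE α _
  have hsplit : ∀ y, conicalIntegral E α (fun x => ∑ z ∈ F, a z * S x z) y ≤
      squareFun E α S μ g y + H y := by
    intro y
    have hTg : ∀ x ∉ E, ∑ z ∈ F, c z * kernelMean E S μ (A z) x = opT E S μ g x := fun x hx =>
      (hS.opT_sum_indicator hE hK₁ hmα hβ F c (fun y hy => (hA y hy).2.2.2.1)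
        (fun y hy => (hA y hy).2.2.2.2.2.2.2) hx).symm
    have e1 : conicalIntegral E α (fun x => ∑ z ∈ F, a z * S x z) y = conicalIntegral E α
        ((fun x => ∑ z ∈ F, c z * kernelMean E S μ (A z) x) + ∑ z ∈ F, b z) y := by
      congr 1
      funext x
      simp [hb]
    rw [e1, squareFun, ← conicalIntegral_congr hE α hTg]
    refine (conicalIntegral_add_le α (Finset.aestronglyMeasurable_fun_sum _ hIm)
      (Finset.aestronglyMeasurable_sum _ hbm) y).trans ?_
    gcongr
    exact conicalIntegral_sum_le α F hbm y
  have hbad : t * μ ({y | t / 2 ≤ H y} ∩ (E \ Ω)) ≤ 2 * localConst n α β m K₁ K₂ c₀ N * V := by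
    have hcheb := mul_meas_ge_le_lintegral (μ := μ.restrict (E \ Ω)) hHm (t / 2)
    rw [Measure.restrict_apply (measurableSet_le measurable_const hHm)] at hcheb
    have hint : ∫⁻ y in E \ Ω, H y ∂μ ≤ localConst n α β m K₁ K₂ c₀ N * V := by
      rw [hH, lintegral_finsetSum _ fun z _ => measurable_conicalIntegral hE α _, hV,
        Finset.mul_sum]
      refine Finset.sum_le_sum fun z hz => ?_
      obtain ⟨hr, hd, hnd, hAm, hAR, hhalf, -, -⟩ := hA z hz
      rw [mul_comm]
      refine (lintegral_mono_set ?_).trans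
        (hS.setLIntegral_conicalIntegral_sub_le hE hK₁ hK₂ hm hα hβ hN hμE (hF z hz)
          (hμ.measure_ball_le (hF z hz)) hr (l z) hd hnd hAm hAR hhalf (hac z hz))
      rintro y ⟨hyE, hyΩ⟩
      refine ⟨hyE, ?_⟩
      by_contra hlt
      refine hyΩ (mem_iUnion₂.2 ⟨z, hz, ?_⟩)
      have hlt' : dist y z < r z := not_le.1 hlt
      rw [Metric.mem_ball]
      linarith
    calc t * μ ({y | t / 2 ≤ H y} ∩ (E \ Ω))
        = 2 * (t / 2 * μ ({y | t / 2 ≤ H y} ∩ (E \ Ω))) := by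
          rw [← mul_assoc, ENNReal.mul_div_cancel (by norm_num) (by norm_num)]
      _ ≤ 2 * (localConst n α β m K₁ K₂ c₀ N * V) := mul_le_mul_right (hcheb.trans hint) _
      _ = _ := by ring
  have hcov : {y ∈ E | t < conicalIntegral E α (fun x => ∑ z ∈ F, a z * S x z) y} ⊆
      Ω ∪ {y | t / 2 ≤ squareFun E α S μ g y} ∪ ({y | t / 2 ≤ H y} ∩ (E \ Ω)) := by
    rintro y ⟨hyE, hy⟩
    by_cases h1 : y ∈ Ω
    · exact Or.inl (Or.inl h1)
    by_cases h2 : t / 2 ≤ squareFun E α S μ g y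
    · exact Or.inl (Or.inr h2)
    refine Or.inr ⟨?_, hyE, h1⟩
    by_contra h3
    have h3' : H y < t / 2 := not_le.1 h3
    have := ENNReal.add_lt_add (not_le.1 h2) h3'
    rw [ENNReal.add_halves] at this
    exact lt_irrefl _ ((hy.trans_le (hsplit y)).trans this)
  calc t * μ _ ≤ t * (μ Ω + μ {y | t / 2 ≤ squareFun E α S μ g y} +
        μ ({y | t / 2 ≤ H y} ∩ (E \ Ω))) := by
        gcongr
        exact (measure_mono hcov).trans ((measure_union_le _ _).trans
          (add_le_add_left (measure_union_le _ _) _))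
    _ = t * μ Ω + t * μ {y | t / 2 ≤ squareFun E α S μ g y} +
        t * μ ({y | t / 2 ≤ H y} ∩ (E \ Ω)) := by ring
    _ ≤ V + 16 * N ^ 2 * D * V + 2 * localConst n α β m K₁ K₂ c₀ N * V :=
        add_le_add (add_le_add hΩ hgood) hbad
    _ = _ := by rw [weakTypeConst]; ring

/-- The weak type estimate for finite combinations of point masses. -/
lemma IsKernel.weakType_atomic (hE : IsClosed E) (hS : IsKernel E α β m K₁ K₂ S)
    (hK₁ : 0 < K₁) (hK₂ : 0 < K₂) (hm : 0 < m) (hα : 0 < α) (hβ : 0 < β)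
    {N : ℝ≥0} (hμ : IsOfOrder E m c₀ μ) (hN : BoundedL2 E α S μ N)
    {F : Finset (EuclideanSpace ℝ (Fin n))} (hF : ∀ y ∈ F, y ∈ E)
    (a : EuclideanSpace ℝ (Fin n) → ℂ) {t : ℝ≥0∞} (ht0 : t ≠ 0) (ht : t ≠ ∞) :
    t * μ {y ∈ E | t < conicalIntegral E α (fun x => ∑ z ∈ F, a z * S x z) y} ≤
      weakTypeConst n α β m K₁ K₂ c₀ N * ∑ y ∈ F, ‖a y‖ₑ := by
  classical
  have h := hS.weakType_atomic_of_ne_zero hE hK₁ hK₂ hm hα hβ hμ hN (F := F.filter (a · ≠ 0))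
    (a := a) (fun y hy => hF y (Finset.mem_filter.1 hy).1) (fun y hy => (Finset.mem_filter.1 hy).2)
    ht0 ht
  have e1 : ∀ x, ∑ z ∈ F with a z ≠ 0, a z * S x z = ∑ z ∈ F, a z * S x z := fun x =>
    Finset.sum_filter_of_ne fun z _ hz h0 => hz (by simp [h0])
  have e2 : ∑ z ∈ F with a z ≠ 0, ‖a z‖ₑ = ∑ z ∈ F, ‖a z‖ₑ :=
    Finset.sum_filter_of_ne fun z _ hz h0 => hz (by simp [h0])
  simpa only [e1, e2] using h

end Atomic

/-! ### Passage from point masses to complex measures -/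

lemma conicalIntegral_le_liminf {n : ℕ} {E : Set (EuclideanSpace ℝ (Fin n))} (hE : IsClosed E)
    (α : ℝ) {g : EuclideanSpace ℝ (Fin n) → ℂ} {f : ℕ → EuclideanSpace ℝ (Fin n) → ℂ}
    (hf : ∀ k, AEStronglyMeasurable (f k) (volume.restrict Eᶜ))
    (hlim : ∀ x ∉ E, Filter.Tendsto (fun k => f k x) Filter.atTop (nhds (g x)))
    (y : EuclideanSpace ℝ (Fin n)) :
    conicalIntegral E α g y ≤
      Filter.liminf (fun k => conicalIntegral E α (f k) y) Filter.atTop := by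
  simp_rw [conicalIntegral_eq_eLpNorm]
  refine Lp.eLpNorm_lim_le_liminf_eLpNorm
    (fun k => (hf k).mono_ac (coneMeasure_absolutelyContinuous α y)) g ?_
  refine (coneMeasure_absolutelyContinuous α y).ae_le ?_
  filter_upwards [ae_restrict_mem hE.measurableSet.compl] with x hx using hlim x hx

/-- If `t` is below the liminf, then `t < G k y` for all large `k`. The sets where this holds from
index `j` on increase with `j`, and continuity from below needs no measurability. -/
lemma measure_lt_liminf_le {X : Type*} [MeasurableSpace X] {μ : Measure X} {s : Set X}
    {G : ℕ → X → ℝ≥0∞} {t c M : ℝ≥0∞}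
    (h : ∀ k, c * μ {y ∈ s | t < G k y} ≤ M) :
    c * μ {y ∈ s | t < Filter.liminf (fun k => G k y) Filter.atTop} ≤ M := by
  set B : ℕ → Set X := fun j => {y ∈ s | ∀ k ≥ j, t < G k y} with hB
  have hmono : Monotone B := fun i j hij y hy => ⟨hy.1, fun k hk => hy.2 k (hij.trans hk)⟩
  have hsub : {y ∈ s | t < Filter.liminf (fun k => G k y) Filter.atTop} ⊆ ⋃ j, B j := by
    rintro y ⟨hys, hy⟩
    obtain ⟨j, hj⟩ := Filter.eventually_atTop.1 (Filter.eventually_lt_of_lt_liminf hy)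
    exact mem_iUnion.2 ⟨j, hys, hj⟩
  calc _ ≤ c * μ (⋃ j, B j) := by gcongr
    _ = ⨆ j, c * μ (B j) := by rw [hmono.measure_iUnion, ENNReal.mul_iSup]
    _ ≤ M := iSup_le fun j => by
      refine le_trans ?_ (h j)
      gcongr
      exact fun y hy => ⟨hy.1, hy.2 j le_rfl⟩

lemma integral_comp_simpleFunc {X Y : Type*} [MeasurableSpace X] (ν : ComplexMeasure X)
    [IsFiniteMeasure ν.variation] (p : SimpleFunc X Y) (h : Y → ℂ) :
    VectorMeasure.integral ν (fun z => h (p z)) (ContinuousLinearMap.mul ℝ ℂ) =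
      ∑ y ∈ p.range, ν (p ⁻¹' {y}) * h y := by
  have hfin : ∀ y, IsFiniteMeasure (ν.restrict (p ⁻¹' {y})).variation := fun y => by
    rw [VectorMeasure.variation_restrict (p.measurableSet_fiber y)]
    infer_instance
  simp_rw [simpleFunc_comp_eq_sum_indicator p h]
  rw [VectorMeasure.integral_finsetSum _ fun y _ =>
    (integrable_const (h y)).indicator (p.measurableSet_fiber y)]
  refine Finset.sum_congr rfl fun y _ => ?_
  have := hfin y
  rw [VectorMeasure.integral_indicator (p.measurableSet_fiber y), VectorMeasure.integral_const,
    VectorMeasure.restrict_apply _ (p.measurableSet_fiber y) MeasurableSet.univ, univ_inter,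
    ContinuousLinearMap.mul_apply', mul_comm]

lemma sum_enorm_fiber_le {X Y : Type*} [MeasurableSpace X] (ν : ComplexMeasure X)
    (p : SimpleFunc X Y) : ∑ y ∈ p.range, ‖ν (p ⁻¹' {y})‖ₑ ≤ ν.variation univ := by
  calc ∑ y ∈ p.range, ‖ν (p ⁻¹' {y})‖ₑ ≤ ∑ y ∈ p.range, ν.variation (p ⁻¹' {y}) :=
        Finset.sum_le_sum fun y _ => ν.enorm_measure_le_variation _
    _ = ν.variation (p ⁻¹' p.range) :=
        sum_measure_preimage_singleton _ fun y _ => p.measurableSet_fiber y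
    _ ≤ _ := measure_mono (subset_univ _)

/-- The weak type estimate for complex measures of finite variation on `E`. -/
lemma IsKernel.weakType {n : ℕ} {E : Set (EuclideanSpace ℝ (Fin n))} {α β m K₁ K₂ c₀ : ℝ}
    {S : EuclideanSpace ℝ (Fin n) → EuclideanSpace ℝ (Fin n) → ℂ}
    {μ : Measure (EuclideanSpace ℝ (Fin n))} (hE : IsClosed E) (hS : IsKernel E α β m K₁ K₂ S)
    (hK₁ : 0 < K₁) (hK₂ : 0 < K₂) (hm : 0 < m) (hα : 0 < α) (hβ : 0 < β)
    {N : ℝ≥0} (hμ : IsOfOrder E m c₀ μ) (hN : BoundedL2 E α S μ N)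
    (ν : ComplexMeasure (EuclideanSpace ℝ (Fin n))) (hν : ν.variation E ≠ ∞)
    {t : ℝ≥0∞} (ht0 : t ≠ 0) (ht : t ≠ ∞) :
    t * μ {y ∈ E | t < squareFunMeasure E α S ν y} ≤
      weakTypeConst n α β m K₁ K₂ c₀ N * ν.variation E := by
  rcases E.eq_empty_or_nonempty with h0 | ⟨y₀, h₀⟩
  · simp [h0]
  have hvar : (ν.restrict E).variation = ν.variation.restrict E :=
    VectorMeasure.variation_restrict hE.measurableSet
  have hfin : IsFiniteMeasure (ν.restrict E).variation := ⟨by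
    rw [hvar, Measure.restrict_apply_univ]; exact hν.lt_top⟩
  have hmα : 0 ≤ m + α := by positivity
  -- Moving the mass of each fibre of `p k` to its value in `E` gives point masses with total at
  -- most `ν.variation E`; their potentials converge off `E` to that of `ν` by dominated
  -- convergence.
  set p := SimpleFunc.approxOn id measurable_id E y₀ h₀ with hp
  have hmem : ∀ k z, p k z ∈ E := fun k z => SimpleFunc.approxOn_mem _ _ _ _
  have hrange : ∀ k, ∀ y ∈ (p k).range, y ∈ E := fun k y hy => by
    obtain ⟨z, rfl⟩ := SimpleFunc.mem_range.1 hy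
    exact hmem k z
  set f : ℕ → EuclideanSpace ℝ (Fin n) → ℂ :=
    fun k x => ∑ y ∈ (p k).range, ν.restrict E ((p k) ⁻¹' {y}) * S x y with hf
  have hlim : ∀ x ∉ E, Filter.Tendsto (fun k => f k x) Filter.atTop
      (nhds (opTMeasure E S ν x)) := by
    intro x hx
    simp_rw [hf, ← integral_comp_simpleFunc]
    refine VectorMeasure.tendsto_integral_of_dominated_convergence
      (fun _ => K₁ * Metric.infDist x E ^ (-(m + α))) (fun k => ?_) (integrable_const _)
      (fun k => .of_forall fun z => hS.norm_le hE hK₁ hmα hx (hmem k z)) ?_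
    · exact ((p k).map (S x)).aestronglyMeasurable
    · rw [hvar]
      filter_upwards [ae_restrict_mem hE.measurableSet] with z hz
      exact (hS.continuousOn hβ hx z hz).tendsto.comp (tendsto_approxOn_id h₀ hz)
  have hfm : ∀ k, AEStronglyMeasurable (f k) (volume.restrict Eᶜ) := fun k =>
    Finset.aestronglyMeasurable_fun_sum _ fun y hy =>
      (hS.measurable y (hrange k y hy)).const_mul _
  have hk : ∀ k, t * μ {y ∈ E | t < conicalIntegral E α (f k) y} ≤
      weakTypeConst n α β m K₁ K₂ c₀ N * ν.variation E := fun k => by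
    refine (hS.weakType_atomic hE hK₁ hK₂ hm hα hβ hμ hN (hrange k)
      (fun y => ν.restrict E ((p k) ⁻¹' {y})) ht0 ht).trans ?_
    gcongr
    refine (sum_enorm_fiber_le (ν.restrict E) (p k)).trans_eq ?_
    rw [hvar, Measure.restrict_apply_univ]
  refine le_trans ?_ (measure_lt_liminf_le hk)
  gcongr
  exact conicalIntegral_le_liminf hE α hfm hlim _

end ConicalSq

theorem theoremB4 (n : ℕ) (α β m K₁ K₂ c₀ : ℝ) (N : ℝ≥0)
    (hα : α ∈ Set.Ioc (0 : ℝ) 1) (hβ : β ∈ Set.Ioc (0 : ℝ) 1) (hm : 0 < m)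
    (hK₁ : 0 < K₁) (hK₂ : 0 < K₂) :
    ∃ A : ℝ≥0, ∀ E : Set (EuclideanSpace ℝ (Fin n)), IsClosed E →
      ∀ S : EuclideanSpace ℝ (Fin n) → EuclideanSpace ℝ (Fin n) → ℂ,
        ConicalSq.IsKernel E α β m K₁ K₂ S →
      ∀ μ : Measure (EuclideanSpace ℝ (Fin n)), ConicalSq.IsOfOrder E m c₀ μ →
        ConicalSq.BoundedL2 E α S μ N →
      ∀ ν ∈ ConicalSq.complexMeasuresOn E,
        AEMeasurable (ConicalSq.squareFunMeasure E α S ν) μ ∧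
        ∀ t : ℝ, 0 < t →
          μ {y ∈ E | ENNReal.ofReal t < ConicalSq.squareFunMeasure E α S ν y} ≤
            A / ENNReal.ofReal t * ν.variation E := by
  refine ⟨(ConicalSq.weakTypeConst n α β m K₁ K₂ c₀ N).toNNReal, fun E hE S hS μ hμ hN ν _ =>
    ⟨(ConicalSq.measurable_conicalIntegral hE α _).aemeasurable, fun t ht => ?_⟩⟩
  rw [ENNReal.coe_toNNReal (ConicalSq.weakTypeConst_ne_top n α β m K₁ K₂ c₀ N)]
  have ht0 : ENNReal.ofReal t ≠ 0 := by simpa using ht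
  -- If the variation is infinite, the right side is infinite because the constant is at least 1.
  by_cases hν : ν.variation E = ∞
  · have hpos : ConicalSq.weakTypeConst n α β m K₁ K₂ c₀ N / ENNReal.ofReal t ≠ 0 := by
      refine (ENNReal.div_pos ?_ ENNReal.ofReal_ne_top).ne'
      simp [ConicalSq.weakTypeConst]
    rw [hν, ENNReal.mul_top hpos]
    exact le_top
  · rw [← ENNReal.mul_div_right_comm,
      ENNReal.le_div_iff_mul_le (Or.inl ht0) (Or.inl ENNReal.ofReal_ne_top), mul_comm]
    exact hS.weakType hE hK₁ hK₂ hm hα.1 hβ.1 hμ hN ν hν ht0 ENNReal.ofReal_ne_top
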